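/- **Setting.** Let $\mathcal S,\mathcal A$ be finite sets with $S$ and $A\ge 1$ elements, $H$ the horizon, with $S>A$ and $S>H^2$. Let $p_h(\cdot\mid s,a)$, $h=1,\dots,H$, be a transition function known to the learner, $s_{\mathrm{init}}\in\mathcal S$ a fixed initial state, $c^k_h(s,a)\in[0,1]$ cost functions and $d^k\in\{0,1,2,\dots\}$ delays ($k=1,\dots,K$), all fixed before the interaction starts; $D=\sum_{k=1}^K d^k$. In episode $k$ the learner plays a policy $\pi^k_h(a\mid s)$ from $s^k_1=s_{\mathrm{init}}$, with $a^k_h\sim\pi^k_h(\cdot\mid s^k_h)$ and $s^k_{h+1}\sim p_h(\cdot\mid s^k_h,a^k_h)$. At the end of episode $k$ it observes, for all $j\in\mathcal F^k=\{j\le k: j+d^j=k\}$, the trajectory $\{(s^j_h,a^j_h)\}_{h=1}^H$ and the suffered costs $\{c^j_h(s^j_h,a^j_h)\}_{h=1}^H$ (bandit feedback). With $V_1^{k,\pi}(s)$ the expected total cost of $\pi$ in an episode from $s$ under $p$ and $c^k$, the regret is $$\mathcal R_K=\sum_{k=1}^K V_1^{k,\pi^k}(s_{\mathrm{init}})-\min_\pi\sum_{k=1}^K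 V_1^{k,\pi}(s_{\mathrm{init}}),$$ the minimum being over all policies $\pi=\{\pi_h(a\mid s)\}$. **Algorithm** (inputs: $\mathcal S,\mathcal A,H,p,s_{\mathrm{init}}$ only; in particular neither $K$ nor $D$). For a phase number $e$ put $\eta_e=H^{-1}2^{-2e/3}$, $\gamma_e=2^{-e/3}$, $\beta_e=2^{e/2}$. Start with $e=1$ and $\pi^1_h(a\mid s)=1/A$. For $k=1,2,\dots$: play $\pi^k$ and observe the feedback of all $j\in\mathcal F^k$. For each $j\in\mathcal F^k$ with $d^j\le\beta_e$ compute, with $V^j_{H+1}=0$, for $h=H,\dots,1$, $$\hat c^j_h(s,a)=\frac{c^j_h(s,a)\,\mathbb I\{s^j_h=s,a^j_h=a\}}{q^{p,\pi^j}_h(s)\,\pi^j_h(a\mid s)+\gamma_e},\quad Q^j_h(s,a)=\hat c^j_h(s,a)+\sum_{s'}p_h(s'\mid s,a)V^j_{h+1}(s'),\quad V^j_h(s)=\sum_a\pi^j_h(a\mid s)Q^j_h(s,a),$$ where $q^{p,\pi}_h(s)=\Pr[s_h=s\mid s_1=s_{\mathrm{init}},\pi,p]$, and set $$\pi^{k+1}_h(a\mid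 s)\propto\pi^k_h(a\mid s)\exp\Bigl(-\eta_e\sum_{j\in\mathcal F^k:\,d^j\le\beta_e}Q^j_h(s,a)\Bigr).$$ Finally, with $M^j=j-\sum_{i=1}^j|\mathcal F^i|$, if $k+\sum_{j=1}^kM^j>2^e$, replace $e$ by $e+1$ and reset $\pi^{k+1}$ to the uniform policy. **Theorem.** There are absolute constants $C>0$ and $n\in\mathbb N$ such that in every such setting, for every $K$ and every $\delta\in(0,1)$, with probability at least $1-\delta$ over the trajectories, $$\mathcal R_K\le C\Bigl(1+\log\frac{HSAK}{\delta}\Bigr)^n\bigl(HSA\,K^{2/3}+H^2D^{2/3}\bigr)$$ (in the trivial cases $H=0$ or $K=0$ both sides are $0$, reading the logarithm as $0$). -/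

import Mathlib

open scoped BigOperators

noncomputable section

namespace DelayedMDP

universe u v

/-- Transition functions `p_h(s' ∣ s, a)`, for the `H` time steps of an episode. -/
abbrev Transition (S : Type u) (A : Type v) (H : ℕ) := Fin H → S → A → PMF S

/-- Stochastic Markov policies `π_h(a ∣ s)`. -/
abbrev Policy (S : Type u) (A : Type v) (H : ℕ) := Fin H → S → PMF A

/-- Functions of time, state and action, such as cost functions `c_h(s, a)`. -/
abbrev CostFn (S : Type u) (A : Type v) (H : ℕ) := Fin H → S → A → ℝ

/-- Trajectories `(s_h, a_h)` of one episode. -/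
abbrev Trajectory (S : Type u) (A : Type v) (H : ℕ) := Fin H → S × A

section MDP

variable {S : Type u} {A : Type v}

/-- Law of the trajectory of an episode started in `s`: at each time step the action is drawn from
the policy and then the next state is drawn from the transition function. -/
def trajectoryLaw : {H : ℕ} → Transition S A H → Policy S A H → S → PMF (Trajectory S A H)
  | 0, _, _, _ => PMF.pure Fin.elim0
  | _ + 1, p, π, s =>
      (π 0 s).bind fun a =>
        (p 0 s a).bind fun s' =>
          (trajectoryLaw (Fin.tail p) (Fin.tail π) s').map
            fun x => Fin.cons (α := fun _ => S × A) (s, a) x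

/-- The value `V_1^π(s)`: expected total cost of an episode that starts in `s`. -/
def value [Fintype S] [Fintype A] {H : ℕ} (p : Transition S A H) (π : Policy S A H)
    (c : CostFn S A H) (s : S) : ℝ :=
  ∑ x : Trajectory S A H, (trajectoryLaw p π s x).toReal * ∑ h, c h (x h).1 (x h).2

/-- The occupancy measure `q_h^{p,π}(s) = Pr[s_h = s ∣ s_1 = s₀, π, p]`. -/
def occupancy {H : ℕ} (p : Transition S A H) (π : Policy S A H) (s₀ : S) (h : Fin H) (s : S) : ℝ :=
  ((trajectoryLaw p π s₀).toOuterMeasure {x | (x h).1 = s}).toReal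

/-- Policy evaluation by backward dynamic programming: `V` at the first time step. -/
def evalV [Fintype S] [Fintype A] :
    {H : ℕ} → Transition S A H → Policy S A H → CostFn S A H → S → ℝ
  | 0, _, _, _, _ => 0
  | _ + 1, p, π, c, s =>
      ∑ a, (c 0 s a + ∑ s', (p 0 s a s').toReal * evalV (Fin.tail p) (Fin.tail π) (Fin.tail c) s')
        * (π 0 s a).toReal

/-- Policy evaluation by backward dynamic programming:
`Q_h(s, a) = c_h(s, a) + ⟨p_h(· ∣ s, a), V_{h+1}⟩` for all time steps `h`. -/
def evalQ [Fintype S] [Fintype A] :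
    {H : ℕ} → Transition S A H → Policy S A H → CostFn S A H → CostFn S A H
  | 0, _, _, _ => Fin.elim0
  | _ + 1, p, π, c =>
      Fin.cons (α := fun _ => S → A → ℝ)
        (fun s a =>
          c 0 s a + ∑ s', (p 0 s a s').toReal * evalV (Fin.tail p) (Fin.tail π) (Fin.tail c) s')
        (evalQ (Fin.tail p) (Fin.tail π) (Fin.tail c))

end MDP

/-! ### The interaction with delayed bandit feedback

Episodes are numbered `1, 2, …`; costs `c k` and delays `d k` are those of episode `k`. A history
`u : Fin k → Trajectory S A H` of `k` episodes holds the trajectory of episode `j + 1` at `j`. -/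

/-- Bandit feedback of one episode: its number, its trajectory, and the costs suffered along it. -/
structure Observation (S : Type u) (A : Type v) (H : ℕ) where
  episode : ℕ
  traj : Trajectory S A H
  cost : Fin H → ℝ

/-- A learner keeps a state, picks a policy as a function of it, and updates it at the end of every
episode with the feedback that arrives then. -/
structure Learner (S : Type u) (A : Type v) (H : ℕ) where
  State : Type (max u v)
  init : State
  policy : State → Policy S A H
  update : State → List (Observation S A H) → State

section Protocol

variable {S : Type u} {A : Type v} {H : ℕ}

/-- The feedback that arrives at the end of episode `k`: that of all `j ≤ k` with `j + d^j = k`. -/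
def feedback (c : ℕ → CostFn S A H) (d : ℕ → ℕ) {k : ℕ} (u : Fin k → Trajectory S A H) :
    List (Observation S A H) :=
  ((List.finRange k).filter fun j : Fin k => ((j : ℕ) + 1) + d ((j : ℕ) + 1) = k).map fun j : Fin k =>
    { episode := (j : ℕ) + 1
      traj := u j
      cost := fun h => c ((j : ℕ) + 1) h (u j h).1 (u j h).2 }

/-- State of the learner after the `k` episodes of a history. -/
def stateAfter (L : Learner S A H) (c : ℕ → CostFn S A H) (d : ℕ → ℕ) :
    {k : ℕ} → (Fin k → Trajectory S A H) → L.State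
  | 0, _ => L.init
  | _ + 1, u => L.update (stateAfter L c d (Fin.init u)) (feedback c d u)

/-- Law of the trajectories of the first `K` episodes. -/
def interactionLaw (L : Learner S A H) (p : Transition S A H) (s₀ : S) (c : ℕ → CostFn S A H)
    (d : ℕ → ℕ) : (K : ℕ) → PMF (Fin K → Trajectory S A H)
  | 0 => PMF.pure Fin.elim0
  | K + 1 =>
      (interactionLaw L p s₀ c d K).bind fun u =>
        (trajectoryLaw p (L.policy (stateAfter L c d u)) s₀).map
          fun x => Fin.snoc (α := fun _ => Trajectory S A H) u x

/-- The policy played in episode `k + 1`, which depends on the first `k` episodes only. -/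
def playedPolicy (L : Learner S A H) (c : ℕ → CostFn S A H) (d : ℕ → ℕ) {K : ℕ}
    (u : Fin K → Trajectory S A H) (k : Fin K) : Policy S A H :=
  L.policy (stateAfter L c d (Fin.take (k : ℕ) k.isLt.le u))

/-- The regret after `K` episodes: cumulative value of the played policies minus that of the best
fixed policy in hindsight. -/
def regret [Fintype S] [Fintype A] (L : Learner S A H) (p : Transition S A H) (s₀ : S)
    (c : ℕ → CostFn S A H) (d : ℕ → ℕ) {K : ℕ} (u : Fin K → Trajectory S A H) : ℝ :=
  ∑ k : Fin K, value p (playedPolicy L c d u k) (c ((k : ℕ) + 1)) s₀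
    - ⨅ π : Policy S A H, ∑ k : Fin K, value p π (c ((k : ℕ) + 1)) s₀

end Protocol

/-! ### Delayed OPPO with known transitions, bandit feedback, skipping and doubling -/

section Algorithm

variable {S : Type u} {A : Type v} {H : ℕ}

/-- The uniform policy `π_h(a ∣ s) = 1 / A`. -/
def uniformPolicy [Fintype A] [Nonempty A] : Policy S A H :=
  fun _ _ => PMF.uniformOfFintype A

/-- The exponential weights update: the distribution proportional to `μ(a) exp(-ℓ(a))`. -/
def expWeights [Fintype A] (μ : PMF A) (ℓ : A → ℝ) : PMF A :=
  PMF.normalize (fun a => μ a * ENNReal.ofReal (Real.exp (-ℓ a)))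
    (by
      obtain ⟨a, ha⟩ := μ.support_nonempty
      intro h0
      have h1 := (ENNReal.tsum_eq_zero.mp h0) a
      rcases mul_eq_zero.mp h1 with h | h
      · exact (μ.mem_support_iff a).mp ha h
      · exact absurd (ENNReal.ofReal_eq_zero.mp h) (not_le.mpr (Real.exp_pos _)))
    (by
      rw [tsum_fintype]
      exact ENNReal.sum_ne_top.mpr fun a _ =>
        ENNReal.mul_ne_top (μ.apply_ne_top a) ENNReal.ofReal_ne_top)

open Classical in
/-- The importance-sampling cost estimator
`ĉ_h(s, a) = c_h(s, a) 𝕀{s_h = s, a_h = a} / (q_h^{p,π}(s) π_h(a ∣ s) + γ)`. -/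
def costEstimator (p : Transition S A H) (s₀ : S) (π : Policy S A H) (γ : ℝ)
    (o : Observation S A H) : CostFn S A H :=
  fun h s a =>
    if o.traj h = (s, a) then o.cost h / (occupancy p π s₀ h s * (π h s a).toReal + γ) else 0

/-- Learning rate `η_e = H⁻¹ 2^{-2e/3}` in phase `e`. -/
def learningRate (H e : ℕ) : ℝ := (H : ℝ)⁻¹ * (2 : ℝ) ^ (-(2 * (e : ℝ)) / 3)

/-- Exploration parameter `γ_e = 2^{-e/3}` in phase `e`. -/
def explorationParam (e : ℕ) : ℝ := (2 : ℝ) ^ (-(e : ℝ) / 3)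

/-- Skipping threshold `β_e = 2^{e/2}` in phase `e`. -/
def skipThreshold (e : ℕ) : ℝ := (2 : ℝ) ^ ((e : ℝ) / 2)

/-- Memory of the algorithm between two episodes. -/
structure OPPOState (S : Type u) (A : Type v) (H : ℕ) where
  /-- number `k` of completed episodes -/
  episode : ℕ
  /-- the policy for the next episode -/
  policy : Policy S A H
  /-- the policies `π^j` of the completed episodes `j` -/
  played : ℕ → Policy S A H
  /-- the current phase `e` -/
  phase : ℕ
  /-- number of episodes whose feedback has arrived, `∑_{i ≤ k} |F^i|` -/
  received : ℕ
  /-- optimistic estimate `k + ∑_{j ≤ k} M^j` of `K + D`, where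
  `M^j = j - ∑_{i ≤ j} |F^i|` -/
  estimate : ℤ

/-- Initial state: uniform policy, phase `1`. -/
def oppoInit [Fintype A] [Nonempty A] : OPPOState S A H where
  episode := 0
  policy := uniformPolicy
  played := fun _ => uniformPolicy
  phase := 1
  received := 0
  estimate := 0

open Classical in
/-- What the algorithm does at the end of episode `k = σ.episode + 1`, with the feedback `F`. -/
def oppoUpdate [Fintype S] [Fintype A] [Nonempty A] (p : Transition S A H) (s₀ : S)
    (σ : OPPOState S A H) (F : List (Observation S A H)) : OPPOState S A H :=
  let k : ℕ := σ.episode + 1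
  let e : ℕ := σ.phase
  let played : ℕ → Policy S A H := Function.update σ.played k σ.policy
  -- feedback with delay at most `β_e`; the delay of episode `j` is `k - j`
  let used := F.filter fun o => (k : ℝ) - (o.episode : ℝ) ≤ skipThreshold e
  -- policy evaluation
  let Q : Observation S A H → CostFn S A H := fun o =>
    evalQ p (played o.episode)
      (costEstimator p s₀ (played o.episode) (explorationParam e) o)
  -- policy improvement
  let improved : Policy S A H := fun h s =>
    expWeights (σ.policy h s) fun a => learningRate H e * (used.map fun o => Q o h s a).sum
  -- doubling
  let received : ℕ := σ.received + F.length
  let estimate : ℤ := σ.estimate + 1 + ((k : ℤ) - (received : ℤ))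
  if (2 : ℤ) ^ e < estimate then
    { episode := k, policy := uniformPolicy, played := played, phase := e + 1,
      received := received, estimate := estimate }
  else
    { episode := k, policy := improved, played := played, phase := e,
      received := received, estimate := estimate }

/-- Delayed OPPO with known transition function, skipping and doubling. Its only inputs are the
transition function and the initial state. -/
def doublingOPPO [Fintype S] [Fintype A] [Nonempty A] (p : Transition S A H) (s₀ : S) :
    Learner S A H where
  State := OPPOState S A H
  init := oppoInit
  policy := fun σ => σ.policy
  update := oppoUpdate p s₀

end Algorithm

end DelayedMDP

end

/-! The regret is bounded phase by phase, on an event where finitely many deviations are small. The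
counters of the algorithm, hence its phases and the choice of feedback used in each, depend on the
delays alone (`runState_fields`). Within a phase every policy is a Gibbs distribution of the
estimated losses used so far (`toReal_runPolicy`), so each pair (h, s) runs exponential weights with
delayed losses.

Call an episode of phase e good if its feedback is used in that phase. In a phase with at least two
episodes the observed delay is at most 2^e when its last episode starts. Hence O(2^(e/2)) episodes
are not good, at cost H each. For good episodes, replacing the true value of the played policy by
its estimated value costs a bias γ·HSA per episode and a fluctuation. The estimated value is then
compared with the true value of the competitor by a performance-difference recursion
(`sum_evalV_sub_evalV_le`). This leaves the excess of estimated over true costs, at most b/γ by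
implicit exploration, and the exponential-weights regret at each (h, s).

`gibbs_delayed_regret` bounds that last regret by log A/η, the competitor's loss on stale feedback
from earlier phases, and η times the products of each loss with the losses used while its feedback
is awaited. Charging overlaps to delays shows that there are O(2^e) of them in total
(`sum_card_overlapSet_le`). With the prescribed parameters a phase of n episodes costs O(γ·HSA·n +
H²·2^(2e/3)·b²) (`phase_regret_le`).

All deviations have conditional exponential moment at most 1. These moments multiply along the
interaction, and Markov's inequality with a union bound gives level b = log(5HSAK/δ). Finally 2^e ≤
2(K + D), while n is at most both K and 2·2^e, so the bias costs K^(2/3) with no delay. The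
condition H² < S absorbs H²K^(2/3), and there are only O(b) phases. -/

open scoped BigOperators

namespace DelayedMDP

universe u v

/-! ### Expectations and exponential moments on finite probability spaces -/

section Expectation

variable {X Y : Type*} [Fintype X] [Fintype Y]

/-- Expectation of a real function under a probability mass function on a finite type. -/
noncomputable def expect (P : PMF X) (f : X → ℝ) : ℝ := ∑ x, (P x).toReal * f x

lemma expect_mono (P : PMF X) {f g : X → ℝ} (h : ∀ x, f x ≤ g x) : expect P f ≤ expect P g :=
  Finset.sum_le_sum fun x _ => mul_le_mul_of_nonneg_left (h x) ENNReal.toReal_nonneg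

lemma expect_add (P : PMF X) (f g : X → ℝ) :
    expect P (fun x => f x + g x) = expect P f + expect P g := by
  simp [expect, mul_add, Finset.sum_add_distrib]

lemma expect_sub (P : PMF X) (f g : X → ℝ) :
    expect P (fun x => f x - g x) = expect P f - expect P g := by
  simp [expect, mul_sub, Finset.sum_sub_distrib]

lemma expect_const_mul (P : PMF X) (r : ℝ) (f : X → ℝ) :
    expect P (fun x => r * f x) = r * expect P f := by
  simp only [expect, Finset.mul_sum]
  exact Finset.sum_congr rfl fun x _ => by ring

lemma expect_mul_const (P : PMF X) (r : ℝ) (f : X → ℝ) :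
    expect P (fun x => f x * r) = expect P f * r := by
  simp only [expect, Finset.sum_mul]
  exact Finset.sum_congr rfl fun x _ => by ring

lemma expect_sum {ι : Type*} (P : PMF X) (t : Finset ι) (f : ι → X → ℝ) :
    expect P (fun x => ∑ i ∈ t, f i x) = ∑ i ∈ t, expect P (f i) := by
  simp only [expect, Finset.mul_sum]
  exact Finset.sum_comm

lemma sum_toReal_eq_one (P : PMF X) : ∑ x, (P x).toReal = 1 := by
  have h := P.tsum_coe
  rw [tsum_fintype] at h
  rw [← ENNReal.toReal_sum fun x _ => P.apply_ne_top x, h, ENNReal.toReal_one]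

lemma expect_const (P : PMF X) (r : ℝ) : expect P (fun _ => r) = r := by
  rw [expect, ← Finset.sum_mul, sum_toReal_eq_one, one_mul]

lemma expect_nonneg (P : PMF X) {f : X → ℝ} (h : ∀ x, 0 ≤ f x) : 0 ≤ expect P f :=
  Finset.sum_nonneg fun x _ => mul_nonneg ENNReal.toReal_nonneg (h x)

lemma expect_le_of_le (P : PMF X) {f : X → ℝ} {r : ℝ} (h : ∀ x, f x ≤ r) : expect P f ≤ r :=
  (expect_mono P h).trans_eq (expect_const P r)

lemma expect_bind (P : PMF X) (Q : X → PMF Y) (f : Y → ℝ) :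
    expect (P.bind Q) f = expect P fun x => expect (Q x) f := by
  simp only [expect, PMF.bind_apply, tsum_fintype, Finset.mul_sum]
  rw [Finset.sum_comm]
  refine Finset.sum_congr rfl fun y _ => ?_
  rw [ENNReal.toReal_sum fun x _ => ENNReal.mul_ne_top (P.apply_ne_top x) ((Q x).apply_ne_top y),
    Finset.sum_mul]
  exact Finset.sum_congr rfl fun x _ => by rw [ENNReal.toReal_mul]; ring

lemma expect_pure (x : X) (f : X → ℝ) : expect (PMF.pure x) f = f x := by
  classical
  rw [expect, Finset.sum_eq_single x]
  · simp
  · intro y _ hy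
    simp [PMF.pure_apply, hy]
  · simp

lemma expect_map (P : PMF X) (g : X → Y) (f : Y → ℝ) :
    expect (P.map g) f = expect P fun x => f (g x) := by
  rw [PMF.map, expect_bind]
  exact congrArg _ (funext fun x => expect_pure _ _)

open Classical in
lemma toReal_toOuterMeasure (P : PMF X) (s : Set X) :
    (P.toOuterMeasure s).toReal = expect P fun x => if x ∈ s then 1 else 0 := by
  rw [PMF.toOuterMeasure_apply, tsum_fintype, ENNReal.toReal_sum]
  · refine Finset.sum_congr rfl fun x _ => ?_
    by_cases hx : x ∈ s <;> simp [hx]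
  · intro x _
    by_cases hx : x ∈ s <;> simp [hx, P.apply_ne_top]

/-- Markov's inequality for a union of finitely many events, in exponential form. -/
lemma one_sub_le_toOuterMeasure {ι : Type*} [Fintype ι] (P : PMF X) (F : ι → X → ℝ) (b δ : ℝ)
    (hF : ∀ i, expect P (fun x => Real.exp (F i x)) ≤ 1)
    (hb : Fintype.card ι * Real.exp (-b) ≤ δ) (s : Set X)
    (hs : ∀ x, (∀ i, F i x ≤ b) → x ∈ s) :
    ENNReal.ofReal (1 - δ) ≤ P.toOuterMeasure s := by
  classical
  have hfin : P.toOuterMeasure s ≠ ⊤ := by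
    rw [PMF.toOuterMeasure_apply, tsum_fintype]
    refine ENNReal.sum_ne_top.2 fun x _ => ?_
    by_cases hx : x ∈ s <;> simp [hx, P.apply_ne_top]
  refine ENNReal.ofReal_le_of_le_toReal ?_
  rw [toReal_toOuterMeasure]
  have h1 : ∀ x, 1 - ∑ i, Real.exp (-b) * Real.exp (F i x) ≤ if x ∈ s then (1 : ℝ) else 0 := by
    intro x
    have hnn : ∀ i, 0 ≤ Real.exp (-b) * Real.exp (F i x) := fun i => by positivity
    split_ifs with hx
    · linarith [Finset.sum_nonneg fun i (_ : i ∈ Finset.univ) => hnn i]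
    · have : ¬ ∀ i, F i x ≤ b := fun h => hx (hs x h)
      push Not at this
      obtain ⟨i, hi⟩ := this
      have h2 : 1 ≤ Real.exp (-b) * Real.exp (F i x) := by
        rw [← Real.exp_add]
        exact Real.one_le_exp (by linarith)
      linarith [Finset.single_le_sum (fun j _ => hnn j) (Finset.mem_univ i)]
  refine le_trans ?_ (expect_mono P h1)
  rw [expect_sub, expect_const, expect_sum]
  have : ∑ i, expect P (fun x => Real.exp (-b) * Real.exp (F i x)) ≤ ∑ _i : ι, Real.exp (-b) := by
    refine Finset.sum_le_sum fun i _ => ?_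
    rw [expect_const_mul]
    exact mul_le_of_le_one_right (Real.exp_pos _).le (hF i)
  simp only [Finset.sum_const, Finset.card_univ, nsmul_eq_mul] at this
  linarith

lemma exp_le_one_add_two_mul {y : ℝ} (h0 : 0 ≤ y) (h1 : y ≤ 1) : Real.exp y ≤ 1 + 2 * y := by
  have := Real.abs_exp_sub_one_le (x := y) (by rwa [abs_of_nonneg h0])
  rw [abs_of_nonneg h0] at this
  linarith [le_abs_self (Real.exp y - 1)]

lemma exp_le_one_add_add_sq {y : ℝ} (h1 : |y| ≤ 1) : Real.exp y ≤ 1 + y + y ^ 2 := by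
  have := Real.abs_exp_sub_one_sub_id_le h1
  linarith [le_abs_self (Real.exp y - 1 - y)]

/-- A bounded nonnegative variable has exponential moment controlled by twice its mean. -/
lemma expect_exp_le_one_of_mean_le (P : PMF X) {Z : X → ℝ} {B m : ℝ} (hB : 0 < B)
    (h0 : ∀ x, 0 ≤ Z x) (h1 : ∀ x, Z x ≤ B) (hm : expect P Z ≤ m) :
    expect P (fun x => Real.exp ((Z x - 2 * m) / B)) ≤ 1 := by
  have h2 : ∀ x, Real.exp ((Z x - 2 * m) / B) ≤ Real.exp (-(2 * m / B)) * (1 + 2 / B * Z x) := by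
    intro x
    have : Real.exp ((Z x - 2 * m) / B) = Real.exp (-(2 * m / B)) * Real.exp (Z x / B) := by
      rw [← Real.exp_add]; congr 1; ring
    rw [this]
    refine mul_le_mul_of_nonneg_left ?_ (Real.exp_pos _).le
    refine (exp_le_one_add_two_mul (div_nonneg (h0 x) hB.le) ((div_le_one hB).2 (h1 x))).trans_eq ?_
    ring
  refine (expect_mono P h2).trans ?_
  rw [expect_const_mul, expect_add, expect_const, expect_const_mul]
  have h3 : 1 + 2 / B * expect P Z ≤ Real.exp (2 * m / B) := by
    have : 2 / B * expect P Z ≤ 2 * m / B := by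
      rw [div_mul_eq_mul_div]
      gcongr
    linarith [Real.add_one_le_exp (2 * m / B)]
  calc _ ≤ Real.exp (-(2 * m / B)) * Real.exp (2 * m / B) := by gcongr
    _ = 1 := by rw [← Real.exp_add]; simp

/-- Lower deviations of a bounded nonnegative variable. -/
lemma expect_exp_neg_le_one (P : PMF X) {Z : X → ℝ} {B m r : ℝ} (hr : 0 ≤ r) (hrB : r * B ≤ 1)
    (h0 : ∀ x, 0 ≤ Z x) (h1 : ∀ x, Z x ≤ B) (hm : m ≤ expect P Z) :
    expect P (fun x => Real.exp (r * (m - Z x) - (r * B) ^ 2)) ≤ 1 := by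
  have h2 : ∀ x, Real.exp (r * (m - Z x) - (r * B) ^ 2) ≤
      Real.exp (r * m - (r * B) ^ 2) * (1 + (r * B) ^ 2 - r * Z x) := by
    intro x
    have : Real.exp (r * (m - Z x) - (r * B) ^ 2) =
        Real.exp (r * m - (r * B) ^ 2) * Real.exp (-(r * Z x)) := by
      rw [← Real.exp_add]; congr 1; ring
    rw [this]
    refine mul_le_mul_of_nonneg_left ?_ (Real.exp_pos _).le
    have h3 : 0 ≤ r * Z x := mul_nonneg hr (h0 x)
    have h4 : r * Z x ≤ r * B := mul_le_mul_of_nonneg_left (h1 x) hr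
    have h5 := exp_le_one_add_add_sq (y := -(r * Z x)) (by rw [abs_neg, abs_of_nonneg h3]; linarith)
    nlinarith
  refine (expect_mono P h2).trans ?_
  rw [expect_const_mul, expect_sub, expect_const, expect_const_mul]
  have h3 : 1 + (r * B) ^ 2 - r * expect P Z ≤ Real.exp (-(r * m - (r * B) ^ 2)) := by
    have : r * m ≤ r * expect P Z := mul_le_mul_of_nonneg_left hm hr
    linarith [Real.add_one_le_exp (-(r * m - (r * B) ^ 2))]
  calc _ ≤ Real.exp (r * m - (r * B) ^ 2) * Real.exp (-(r * m - (r * B) ^ 2)) := by gcongr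
    _ = 1 := by rw [← Real.exp_add]; simp

/-- Implicit exploration: the exponential moment of the biased importance-sampling estimator of a
number in `[0, 1]` that is observed on an event of probability `q`. -/
lemma expect_exp_implicit_exploration (P : PMF X) (E : X → Prop) [DecidablePred E]
    {q y g : ℝ} (hg : 0 < g)
    (hq : expect P (fun x => if E x then 1 else 0) = q) (hy0 : 0 ≤ y) (hy1 : y ≤ 1) :
    expect P (fun x => Real.exp (g * ((if E x then y / (q + g) else 0) - y))) ≤ 1 := by
  have hq0 : 0 ≤ q := hq ▸ expect_nonneg P fun x => by split_ifs <;> norm_num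
  have hpos : 0 < q + g := by linarith
  set z := g * (y / (q + g)) with hz
  have hz0 : 0 ≤ z := by positivity
  have hz1 : z ≤ 1 := by
    rw [hz, mul_div_assoc', div_le_one hpos]
    nlinarith
  have h2 : ∀ x, Real.exp (g * ((if E x then y / (q + g) else 0) - y)) ≤
      Real.exp (-(g * y)) * (1 + (z + z ^ 2) * if E x then 1 else 0) := by
    intro x
    split_ifs with hx
    · have : g * (y / (q + g) - y) = -(g * y) + z := by rw [hz]; ring
      rw [this, Real.exp_add]
      refine mul_le_mul_of_nonneg_left ?_ (Real.exp_pos _).le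
      have := exp_le_one_add_add_sq (y := z) (by rwa [abs_of_nonneg hz0])
      linarith
    · simp
  refine (expect_mono P h2).trans ?_
  rw [expect_const_mul, expect_add, expect_const, expect_const_mul, hq]
  -- Since y ≤ 1, this reduces to q(q + 2g) ≤ (q + g)²: the bias g in the denominator pays for the
  -- second-order term.
  have h3 : (z + z ^ 2) * q ≤ g * y := by
    have h4 : z + z ^ 2 ≤ g * y * (1 / (q + g) + g / (q + g) ^ 2) := by
      have : z ^ 2 ≤ g * y * (g / (q + g) ^ 2) := by
        rw [hz, mul_div_assoc', div_pow, mul_div_assoc']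
        gcongr
        nlinarith [mul_nonneg hg.le hy0, mul_nonneg (mul_nonneg hg.le hg.le) (mul_nonneg hy0 (sub_nonneg.2 hy1))]
      rw [mul_add]
      have h5 : z = g * y * (1 / (q + g)) := by rw [hz]; ring
      linarith
    have h6 : (1 / (q + g) + g / (q + g) ^ 2) * q ≤ 1 := by
      have : (1 / (q + g) + g / (q + g) ^ 2) * q = (q * (q + 2 * g)) / (q + g) ^ 2 := by
        field_simp; ring
      rw [this, div_le_one (by positivity)]
      nlinarith
    calc (z + z ^ 2) * q ≤ g * y * (1 / (q + g) + g / (q + g) ^ 2) * q := by gcongr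
      _ = g * y * ((1 / (q + g) + g / (q + g) ^ 2) * q) := by ring
      _ ≤ g * y * 1 := by gcongr
      _ = g * y := mul_one _
  calc _ ≤ Real.exp (-(g * y)) * Real.exp (g * y) := by
        gcongr
        linarith [Real.add_one_le_exp (g * y)]
    _ = 1 := by rw [← Real.exp_add]; simp

end Expectation

/-! ### Policy evaluation and performance difference -/

section Evaluation

variable {S : Type u} {A : Type v} [Fintype S] [Fintype A]

lemma evalV_succ {H : ℕ} (p : Transition S A (H + 1)) (π : Policy S A (H + 1))
    (c : CostFn S A (H + 1)) (s : S) :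
    evalV p π c s = expect (π 0 s) fun a => c 0 s a +
      expect (p 0 s a) fun s' => evalV (Fin.tail p) (Fin.tail π) (Fin.tail c) s' := by
  simp only [evalV, expect]
  exact Finset.sum_congr rfl fun a _ => mul_comm _ _

lemma evalQ_zero {H : ℕ} (p : Transition S A (H + 1)) (π : Policy S A (H + 1))
    (c : CostFn S A (H + 1)) (s : S) (a : A) :
    evalQ p π c 0 s a = c 0 s a +
      expect (p 0 s a) fun s' => evalV (Fin.tail p) (Fin.tail π) (Fin.tail c) s' := by
  simp only [evalQ, expect, Fin.cons_zero]

lemma evalQ_succ {H : ℕ} (p : Transition S A (H + 1)) (π : Policy S A (H + 1))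
    (c : CostFn S A (H + 1)) (h : Fin H) :
    evalQ p π c h.succ = evalQ (Fin.tail p) (Fin.tail π) (Fin.tail c) h := by
  simp only [evalQ, Fin.cons_succ]

lemma evalV_eq_expect_evalQ {H : ℕ} (p : Transition S A (H + 1)) (π : Policy S A (H + 1))
    (c : CostFn S A (H + 1)) (s : S) :
    evalV p π c s = expect (π 0 s) fun a => evalQ p π c 0 s a := by
  simp only [evalV_succ, evalQ_zero]

lemma expect_trajectoryLaw_succ {H : ℕ} (p : Transition S A (H + 1)) (π : Policy S A (H + 1))
    (s : S) (f : Trajectory S A (H + 1) → ℝ) :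
    expect (trajectoryLaw p π s) f = expect (π 0 s) fun a => expect (p 0 s a) fun s' =>
      expect (trajectoryLaw (Fin.tail p) (Fin.tail π) s') fun x =>
        f (Fin.cons (α := fun _ => S × A) (s, a) x) := by
  simp only [trajectoryLaw, expect_bind, expect_map]

lemma value_eq_expect {H : ℕ} (p : Transition S A H) (π : Policy S A H) (c : CostFn S A H) (s : S) :
    value p π c s = expect (trajectoryLaw p π s) fun x => ∑ h, c h (x h).1 (x h).2 := rfl

lemma value_eq_evalV {H : ℕ} (p : Transition S A H) (π : Policy S A H) (c : CostFn S A H) (s : S) :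
    value p π c s = evalV p π c s := by
  induction H generalizing s with
  | zero => simp [value, evalV]
  | succ H ih =>
    rw [value_eq_expect, expect_trajectoryLaw_succ, evalV_succ]
    simp only [Fin.sum_univ_succ, Fin.cons_zero, Fin.cons_succ, expect_add, expect_const]
    simp only [← ih, value_eq_expect]
    rfl

lemma evalV_nonneg {H : ℕ} (p : Transition S A H) (π : Policy S A H) (c : CostFn S A H)
    (hc : ∀ h s a, 0 ≤ c h s a) (s : S) : 0 ≤ evalV p π c s := by
  induction H generalizing s with
  | zero => simp [evalV]
  | succ H ih =>
    rw [evalV_succ]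
    exact expect_nonneg _ fun a => add_nonneg (hc _ _ _)
      (expect_nonneg _ fun s' => ih _ _ _ (fun h s a => hc h.succ s a) s')

lemma evalQ_nonneg {H : ℕ} (p : Transition S A H) (π : Policy S A H) (c : CostFn S A H)
    (hc : ∀ h s a, 0 ≤ c h s a) (h : Fin H) (s : S) (a : A) : 0 ≤ evalQ p π c h s a := by
  induction H with
  | zero => exact h.elim0
  | succ H ih =>
    refine Fin.cases ?_ (fun h => ?_) h
    · rw [evalQ_zero]
      exact add_nonneg (hc _ _ _)
        (expect_nonneg _ fun s' => evalV_nonneg _ _ _ (fun h s a => hc h.succ s a) s')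
    · rw [evalQ_succ]
      exact ih _ _ _ (fun h s a => hc h.succ s a) h

lemma evalV_le {H : ℕ} (p : Transition S A H) (π : Policy S A H) (c : CostFn S A H) {B : ℝ}
    (hc : ∀ h s a, c h s a ≤ B) (s : S) : evalV p π c s ≤ H * B := by
  induction H generalizing s with
  | zero => simp [evalV]
  | succ H ih =>
    rw [evalV_succ]
    refine expect_le_of_le _ fun a => ?_
    have := expect_le_of_le (p 0 s a) fun s' =>
      ih (Fin.tail p) (Fin.tail π) (Fin.tail c) (fun h s a => hc h.succ s a) s'
    push_cast
    linarith [hc 0 s a]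

lemma evalQ_le {H : ℕ} (p : Transition S A H) (π : Policy S A H) (c : CostFn S A H) {B : ℝ}
    (hB : 0 ≤ B) (hc : ∀ h s a, c h s a ≤ B) (h : Fin H) (s : S) (a : A) :
    evalQ p π c h s a ≤ H * B := by
  induction H with
  | zero => exact h.elim0
  | succ H ih =>
    push_cast
    refine Fin.cases ?_ (fun h => ?_) h
    · rw [evalQ_zero]
      have := expect_le_of_le (p 0 s a) fun s' =>
        evalV_le (Fin.tail p) (Fin.tail π) (Fin.tail c) (fun h s a => hc h.succ s a) s'
      linarith [hc 0 s a]
    · rw [evalQ_succ]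
      have := ih (Fin.tail p) (Fin.tail π) (Fin.tail c) (fun h s a => hc h.succ s a) h
      linarith

lemma expect_comm {X Y : Type*} [Fintype X] [Fintype Y] (P : PMF X) (Q : PMF Y) (f : X → Y → ℝ) :
    expect P (fun x => expect Q (f x)) = expect Q fun y => expect P fun x => f x y := by
  simp only [expect, Finset.mul_sum]
  rw [Finset.sum_comm]
  exact Finset.sum_congr rfl fun _ _ => Finset.sum_congr rfl fun _ _ => by ring

/-- Evaluation is linear in the costs, so the average over trajectories passes through the
recursion. -/
lemma expect_evalV {X : Type*} [Fintype X] (P : PMF X) {H : ℕ} (p : Transition S A H)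
    (π : Policy S A H) (c : X → CostFn S A H) (s : S) :
    expect P (fun x => evalV p π (c x) s) =
      evalV p π (fun h s a => expect P fun x => c x h s a) s := by
  induction H generalizing s with
  | zero => simp [evalV, expect]
  | succ H ih =>
    simp only [evalV_succ]
    rw [expect_comm]
    simp only [expect_add]
    refine congrArg _ (congrArg _ (funext fun a => ?_))
    rw [expect_comm]
    exact congrArg _ (funext fun s' => ih _ _ _ s')

lemma expect_evalQ {X : Type*} [Fintype X] (P : PMF X) {H : ℕ} (p : Transition S A H)
    (π : Policy S A H) (c : X → CostFn S A H) (h : Fin H) (s : S) (a : A) :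
    expect P (fun x => evalQ p π (c x) h s a) =
      evalQ p π (fun h s a => expect P fun x => c x h s a) h s a := by
  induction H with
  | zero => exact h.elim0
  | succ H ih =>
    refine Fin.cases ?_ (fun h => ?_) h
    · simp only [evalQ_zero, expect_add]
      refine congrArg _ ?_
      rw [expect_comm]
      exact congrArg _ (funext fun s' => expect_evalV P _ _ _ s')
    · simp only [evalQ_succ]
      exact ih _ _ _ h

/-- Performance difference with perturbed costs, summed over a family of policies. -/
lemma sum_evalV_sub_evalV_le {ι : Type*} (J : Finset ι) {H : ℕ} (p : Transition S A H)
    (π : ι → Policy S A H) (π' : Policy S A H) (c' c : ι → CostFn S A H) {B₁ B₂ : ℝ}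
    (h₁ : ∀ h s, ∑ j ∈ J, (expect (π j h s) (fun a => evalQ p (π j) (c' j) h s a) -
      expect (π' h s) (fun a => evalQ p (π j) (c' j) h s a)) ≤ B₁)
    (h₂ : ∀ h s a, ∑ j ∈ J, (c' j h s a - c j h s a) ≤ B₂) (s : S) :
    ∑ j ∈ J, (evalV p (π j) (c' j) s - evalV p π' (c j) s) ≤ H * (B₁ + B₂) := by
  induction H generalizing s with
  | zero => simp [evalV]
  | succ H ih =>
    -- Change the policy at the first step only, keeping the perturbed `Q`-function. What remains is
    -- a change of cost and the same difference one step later, averaged under π', which does not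
    -- depend on j, so the sum over j can move inside.
    have key : ∀ j, evalV p (π j) (c' j) s - evalV p π' (c j) s =
        (expect (π j 0 s) (fun a => evalQ p (π j) (c' j) 0 s a) -
          expect (π' 0 s) (fun a => evalQ p (π j) (c' j) 0 s a)) +
        expect (π' 0 s) (fun a => (c' j 0 s a - c j 0 s a) + expect (p 0 s a) fun s' =>
          (evalV (Fin.tail p) (Fin.tail (π j)) (Fin.tail (c' j)) s' -
            evalV (Fin.tail p) (Fin.tail π') (Fin.tail (c j)) s')) := by
      intro j
      rw [evalV_eq_expect_evalQ, evalV_succ p π']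
      simp only [evalQ_zero, expect_add, expect_sub]
      ring
    rw [Finset.sum_congr rfl fun j _ => key j, Finset.sum_add_distrib, ← expect_sum]
    simp only [Finset.sum_add_distrib, ← expect_sum]
    have h3 : expect (π' 0 s) (fun a => ∑ j ∈ J, (c' j 0 s a - c j 0 s a) +
        expect (p 0 s a) fun s' => ∑ j ∈ J,
          (evalV (Fin.tail p) (Fin.tail (π j)) (Fin.tail (c' j)) s' -
            evalV (Fin.tail p) (Fin.tail π') (Fin.tail (c j)) s')) ≤ B₂ + H * (B₁ + B₂) := by
      refine expect_le_of_le _ fun a => add_le_add (h₂ 0 s a) (expect_le_of_le _ fun s' => ?_)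
      refine ih (Fin.tail p) (fun j => Fin.tail (π j)) (Fin.tail π') (fun j => Fin.tail (c' j))
        (fun j => Fin.tail (c j)) (fun h s => ?_) (fun h s a => h₂ h.succ s a) s'
      have := h₁ h.succ s
      simp only [evalQ_succ] at this
      exact this
    push_cast
    linarith [h₁ 0 s]

open Classical in
/-- The probability of a state-action pair factors through the occupancy measure. -/
lemma expect_visit {H : ℕ} (p : Transition S A H) (π : Policy S A H) (s₀ : S) (h : Fin H)
    (s : S) (a : A) :
    expect (trajectoryLaw p π s₀) (fun x => if x h = (s, a) then 1 else 0) =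
      occupancy p π s₀ h s * (π h s a).toReal := by
  rw [occupancy, toReal_toOuterMeasure]
  simp only [Set.mem_ofPred_eq]
  induction H generalizing s₀ with
  | zero => exact h.elim0
  | succ H ih =>
    rw [expect_trajectoryLaw_succ, expect_trajectoryLaw_succ]
    refine Fin.cases ?_ (fun h => ?_) h
    · simp only [Fin.cons_zero, expect_const, Prod.mk.injEq]
      by_cases hs : s₀ = s
      · subst hs
        simp [expect]
      · simp [hs, expect]
    · simp only [Fin.cons_succ, ih, expect_mul_const]
      rfl

/-- Importance-sampling estimate of the costs of an episode from its trajectory. -/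
noncomputable def estimatedCost {H : ℕ} (p : Transition S A H) (s₀ : S) (γ : ℝ) (c : CostFn S A H)
    (π : Policy S A H) (x : Trajectory S A H) : CostFn S A H :=
  costEstimator p s₀ π γ ⟨0, x, fun h => c h (x h).1 (x h).2⟩

omit [Fintype S] [Fintype A] in
open Classical in
lemma estimatedCost_apply {H : ℕ} (p : Transition S A H) (s₀ : S) (γ : ℝ) (c : CostFn S A H)
    (π : Policy S A H) (x : Trajectory S A H) (h : Fin H) (s : S) (a : A) :
    estimatedCost p s₀ γ c π x h s a =
      if x h = (s, a) then c h s a / (occupancy p π s₀ h s * (π h s a).toReal + γ) else 0 := by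
  simp only [estimatedCost, costEstimator]
  split_ifs with hx
  · rw [hx]
  · rfl

omit [Fintype S] [Fintype A] in
lemma occupancy_mul_nonneg {H : ℕ} (p : Transition S A H) (π : Policy S A H) (s₀ : S) (h : Fin H)
    (s : S) (a : A) : 0 ≤ occupancy p π s₀ h s * (π h s a).toReal :=
  mul_nonneg ENNReal.toReal_nonneg ENNReal.toReal_nonneg

/-! ### Range, mean and bias of the importance-sampling estimates -/

section Estimator

variable {H : ℕ} (p : Transition S A H) (s₀ : S) {γ : ℝ} (hγ : 0 < γ) {c : CostFn S A H}
  (hc : ∀ h s a, c h s a ∈ Set.Icc (0 : ℝ) 1) (π : Policy S A H)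
include hγ hc

omit [Fintype S] [Fintype A] in
lemma estimatedCost_nonneg (x : Trajectory S A H) (h : Fin H) (s : S) (a : A) :
    0 ≤ estimatedCost p s₀ γ c π x h s a := by
  rw [estimatedCost_apply]
  split_ifs
  · exact div_nonneg (hc h s a).1 (add_nonneg (occupancy_mul_nonneg ..) hγ.le)
  · exact le_rfl

omit [Fintype S] [Fintype A] in
lemma estimatedCost_le (x : Trajectory S A H) (h : Fin H) (s : S) (a : A) :
    estimatedCost p s₀ γ c π x h s a ≤ 1 / γ := by
  rw [estimatedCost_apply]
  split_ifs
  · exact div_le_div₀ zero_le_one (hc h s a).2 hγ (by linarith [occupancy_mul_nonneg p π s₀ h s a])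
  · positivity

omit hγ hc in
lemma expect_estimatedCost (h : Fin H) (s : S) (a : A) :
    expect (trajectoryLaw p π s₀) (fun x => estimatedCost p s₀ γ c π x h s a) =
      c h s a * ((occupancy p π s₀ h s * (π h s a).toReal) /
        (occupancy p π s₀ h s * (π h s a).toReal + γ)) := by
  classical
  have : ∀ x, estimatedCost p s₀ γ c π x h s a =
      c h s a / (occupancy p π s₀ h s * (π h s a).toReal + γ) *
        if x h = (s, a) then 1 else 0 := fun x => by
    rw [estimatedCost_apply]; split_ifs <;> simp
  simp only [this]
  rw [expect_const_mul, expect_visit]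
  ring

lemma expect_estimatedCost_le_one (h : Fin H) (s : S) (a : A) :
    expect (trajectoryLaw p π s₀) (fun x => estimatedCost p s₀ γ c π x h s a) ≤ 1 := by
  rw [expect_estimatedCost]
  have h0 := occupancy_mul_nonneg p π s₀ h s a
  refine mul_le_one₀ (hc h s a).2 (by positivity) ((div_le_one (by positivity)).2 (by linarith))

open Classical in
lemma expect_exp_estimatedCost_sub_le_one (h : Fin H) (s : S) (a : A) :
    expect (trajectoryLaw p π s₀) (fun x =>
      Real.exp (γ * (estimatedCost p s₀ γ c π x h s a - c h s a))) ≤ 1 := by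
  have hq := expect_visit p π s₀ h s a
  have key := expect_exp_implicit_exploration (trajectoryLaw p π s₀) (fun x => x h = (s, a)) hγ hq
    (hc h s a).1 (hc h s a).2
  refine le_trans (expect_mono _ fun x => ?_) key
  rw [estimatedCost_apply]

lemma evalQ_estimatedCost_nonneg (x : Trajectory S A H) (h : Fin H) (s : S) (a : A) :
    0 ≤ evalQ p π (estimatedCost p s₀ γ c π x) h s a :=
  evalQ_nonneg _ _ _ (estimatedCost_nonneg p s₀ hγ hc π x) h s a

lemma evalQ_estimatedCost_le (x : Trajectory S A H) (h : Fin H) (s : S) (a : A) :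
    evalQ p π (estimatedCost p s₀ γ c π x) h s a ≤ H / γ := by
  have := evalQ_le p π _ (by positivity) (estimatedCost_le p s₀ hγ hc π x) h s a
  rwa [mul_one_div] at this

/-- By linearity the mean is an evaluation of costs at most 1. A mean H against a range H/γ is what
makes upper deviations cost only bH/γ in total. -/
lemma expect_evalQ_estimatedCost_le (h : Fin H) (s : S) (a : A) :
    expect (trajectoryLaw p π s₀) (fun x => evalQ p π (estimatedCost p s₀ γ c π x) h s a) ≤ H := by
  rw [expect_evalQ]
  simpa using evalQ_le p π _ zero_le_one (expect_estimatedCost_le_one p s₀ hγ hc π) h s a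

omit hγ hc in
lemma value_eq_sum_visit (c' : CostFn S A H) :
    value p π c' s₀ = ∑ h, ∑ s, ∑ a, c' h s a * (occupancy p π s₀ h s * (π h s a).toReal) := by
  classical
  simp only [← expect_visit, ← expect_const_mul, ← expect_sum]
  rw [value_eq_expect]
  refine congrArg _ (funext fun x => Finset.sum_congr rfl fun h _ => ?_)
  rw [Finset.sum_eq_single (x h).1 (fun s _ hs => ?_) (by simp),
    Finset.sum_eq_single (x h).2 (fun a _ ha => ?_) (by simp)]
  · simp
  · rw [if_neg fun h => ha (by rw [h]), mul_zero]
  · refine Finset.sum_eq_zero fun a _ => ?_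
    rw [if_neg fun h => hs (by rw [h]), mul_zero]

/-- Evaluating the estimate under the policy that produced it multiplies by the visiting probability
again, which cancels the denominator: each step contributes at most 1, without the factor 1/γ. -/
lemma value_estimatedCost_le (x : Trajectory S A H) :
    value p π (estimatedCost p s₀ γ c π x) s₀ ≤ H := by
  classical
  rw [value_eq_sum_visit]
  have : ∀ h : Fin H, ∑ s, ∑ a, estimatedCost p s₀ γ c π x h s a *
      (occupancy p π s₀ h s * (π h s a).toReal) ≤ 1 := by
    intro h
    rw [Finset.sum_eq_single (x h).1 (fun s _ hs => ?_) (by simp),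
      Finset.sum_eq_single (x h).2 (fun a _ ha => ?_) (by simp)]
    · have h0 := occupancy_mul_nonneg p π s₀ h (x h).1 (x h).2
      rw [estimatedCost_apply, if_pos rfl, div_mul_eq_mul_div, div_le_one (by positivity)]
      nlinarith [(hc h (x h).1 (x h).2).2]
    · rw [estimatedCost_apply, if_neg fun h => ha (by rw [h]), zero_mul]
    · refine Finset.sum_eq_zero fun a _ => ?_
      rw [estimatedCost_apply, if_neg fun h => hs (by rw [h]), zero_mul]
  calc _ ≤ ∑ _h : Fin H, (1 : ℝ) := Finset.sum_le_sum fun h _ => this h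
    _ = H := by simp

lemma value_estimatedCost_nonneg (x : Trajectory S A H) :
    0 ≤ value p π (estimatedCost p s₀ γ c π x) s₀ := by
  rw [value_eq_evalV]
  exact evalV_nonneg _ _ _ (estimatedCost_nonneg p s₀ hγ hc π x) _

/-- With visiting probability q, each triple (h, s, a) loses c·q·γ/(q + γ) ≤ γ. -/
lemma value_sub_le_expect_value_estimatedCost :
    value p π c s₀ - γ * (H * Fintype.card S * Fintype.card A) ≤
      expect (trajectoryLaw p π s₀) fun x => value p π (estimatedCost p s₀ γ c π x) s₀ := by
  simp only [value_eq_sum_visit p s₀ π, expect_sum, expect_mul_const]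
  have h1 : γ * (H * Fintype.card S * Fintype.card A) = ∑ _h : Fin H, ∑ _s : S, ∑ _a : A, γ := by
    simp; ring
  rw [h1]
  simp only [← Finset.sum_sub_distrib]
  refine Finset.sum_le_sum fun h _ => Finset.sum_le_sum fun s _ => Finset.sum_le_sum fun a _ => ?_
  rw [expect_estimatedCost]
  have h0 := occupancy_mul_nonneg p π s₀ h s a
  set q := occupancy p π s₀ h s * (π h s a).toReal
  obtain ⟨hc0, hc1⟩ := hc h s a
  have h2 : c h s a * q - c h s a * (q / (q + γ)) * q = c h s a * (q / (q + γ)) * γ := by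
    field_simp; ring
  have h3 : c h s a * (q / (q + γ)) ≤ 1 :=
    mul_le_one₀ hc1 (by positivity) ((div_le_one (by positivity)).2 (by linarith))
  nlinarith

end Estimator

end Evaluation

/-! ### The doubling schedule as a function of the delays -/

section Schedule

/-- The quantity `n + ∑_{j ≤ n} M^j` in terms of the delays `D i` of episodes `i = 0, 1, …`. -/
def seenDelay (D : ℕ → ℕ) (n : ℕ) : ℕ := n + ∑ i ∈ Finset.range n, min (D i) (n - i)

/-- Number of episodes whose feedback has arrived after `n` episodes. -/
def receivedCount (D : ℕ → ℕ) (n : ℕ) : ℕ := ∑ i ∈ Finset.range n, if i + D i < n then 1 else 0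

/-- Phase during episode `n`. -/
def phaseAt (D : ℕ → ℕ) : ℕ → ℕ
  | 0 => 1
  | n + 1 => if 2 ^ phaseAt D n < seenDelay D (n + 1) then phaseAt D n + 1 else phaseAt D n

/-- The feedback of episode `i` is used in phase `e`. -/
def UsedIn (D : ℕ → ℕ) (e i : ℕ) : Prop :=
  phaseAt D (i + D i) = e ∧ (D i : ℝ) ≤ skipThreshold e

variable (D : ℕ → ℕ)

lemma receivedCount_succ (m : ℕ) :
    receivedCount D (m + 1) = receivedCount D m +
      ∑ i ∈ Finset.range (m + 1), if i + D i = m then 1 else 0 := by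
  have : receivedCount D m = ∑ i ∈ Finset.range (m + 1), if i + D i < m then 1 else 0 := by
    rw [Finset.sum_range_succ, if_neg (by omega), add_zero, receivedCount]
  rw [this, receivedCount, ← Finset.sum_add_distrib]
  refine Finset.sum_congr rfl fun i _ => ?_
  split_ifs <;> omega

/-- Each of the first m + 1 episodes either has arrived or sees its truncated delay grow by one.
This turns the running sum of missing feedback into a sum of truncated delays. -/
lemma seenDelay_succ_add (m : ℕ) :
    seenDelay D (m + 1) + receivedCount D (m + 1) = seenDelay D m + 1 + (m + 1) := by
  have h1 : ∑ i ∈ Finset.range m, min (D i) (m - i) =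
      ∑ i ∈ Finset.range (m + 1), min (D i) (m - i) := by
    rw [Finset.sum_range_succ]; simp
  have h2 : ∑ i ∈ Finset.range (m + 1), min (D i) (m + 1 - i) +
      (∑ i ∈ Finset.range (m + 1), if i + D i < m + 1 then 1 else 0) =
      ∑ i ∈ Finset.range (m + 1), min (D i) (m - i) + ∑ i ∈ Finset.range (m + 1), 1 := by
    rw [← Finset.sum_add_distrib, ← Finset.sum_add_distrib]
    refine Finset.sum_congr rfl fun i hi => ?_
    have := Finset.mem_range.1 hi
    split_ifs <;> omega
  simp only [Finset.sum_const, Finset.card_range, smul_eq_mul, mul_one] at h2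
  simp only [seenDelay, receivedCount, h1]
  omega

lemma phaseAt_mono : Monotone (phaseAt D) := by
  refine monotone_nat_of_le_succ fun n => ?_
  rw [phaseAt]
  split_ifs <;> omega

end Schedule

/-! ### Exponential weights as Gibbs distributions -/

section Weights

variable {A : Type*} [Fintype A]

/-- The distribution proportional to `exp (-L a)`. -/
noncomputable def gibbs (L : A → ℝ) (a : A) : ℝ := Real.exp (-L a) / ∑ b, Real.exp (-L b)

lemma toReal_uniform [Nonempty A] (a : A) :
    (PMF.uniformOfFintype A a).toReal = gibbs (fun _ => 0) a := by
  simp [gibbs]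

lemma toReal_expWeights (μ : PMF A) (ℓ L : A → ℝ) (hμ : ∀ a, (μ a).toReal = gibbs L a) (a : A) :
    (expWeights μ ℓ a).toReal = gibbs (fun a => L a + ℓ a) a := by
  have hne : ∀ b ∈ Finset.univ, μ b * ENNReal.ofReal (Real.exp (-ℓ b)) ≠ ⊤ := fun b _ =>
    ENNReal.mul_ne_top (μ.apply_ne_top b) ENNReal.ofReal_ne_top
  have hZ : 0 < ∑ b, Real.exp (-L b) :=
    Finset.sum_pos (fun b _ => Real.exp_pos _) ⟨a, Finset.mem_univ a⟩
  rw [expWeights, PMF.normalize_apply, tsum_fintype, ENNReal.toReal_mul, ENNReal.toReal_inv,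
    ENNReal.toReal_sum hne]
  simp only [ENNReal.toReal_mul, ENNReal.toReal_ofReal (Real.exp_pos _).le, hμ, gibbs, neg_add,
    Real.exp_add, div_mul_eq_mul_div, ← Finset.sum_div]
  field_simp

end Weights

lemma sum_map_filter {ι : Type*} (l : List ι) (q : ι → Bool) (f : ι → ℝ) :
    ((l.filter q).map f).sum = (l.map fun i => if q i then f i else 0).sum := by
  induction l with
  | nil => rfl
  | cons i l ih =>
    by_cases hi : q i <;> simp [hi, ih]

lemma length_filter_eq_sum {ι : Type*} (l : List ι) (q : ι → Bool) :
    (l.filter q).length = (l.map fun i => if q i then 1 else 0).sum := by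
  induction l with
  | nil => rfl
  | cons i l ih =>
    by_cases hi : q i <;> simp [hi, ih]; omega

/-! ### The state and the policies of the algorithm in closed form -/

section Run

variable {S : Type u} {A : Type v} [Fintype S] [Fintype A] [Nonempty A] {H : ℕ}
  (p : Transition S A H) (s₀ : S) (c : ℕ → CostFn S A H) (d : ℕ → ℕ) (ω : ℕ → Trajectory S A H)

/-- State of the algorithm after `m` episodes with trajectories `ω 0, …, ω (m - 1)`. -/
noncomputable def runState (m : ℕ) : OPPOState S A H :=
  stateAfter (doublingOPPO p s₀) c d fun i : Fin m => ω i

/-- Policy of episode `m`, counted from `0`. -/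
noncomputable def runPolicy (m : ℕ) : Policy S A H := (runState p s₀ c d ω m).policy

/-- The `Q`-function computed in phase `e` from the feedback of episode `i`. -/
noncomputable def estimatedQ (e i : ℕ) : CostFn S A H :=
  evalQ p (runPolicy p s₀ c d ω i)
    (estimatedCost p s₀ (explorationParam e) (c (i + 1)) (runPolicy p s₀ c d ω i) (ω i))

lemma runState_succ (m : ℕ) : runState p s₀ c d ω (m + 1) =
    oppoUpdate p s₀ (runState p s₀ c d ω m) (feedback c d fun i : Fin (m + 1) => ω i) := rfl

omit [Fintype S] [Fintype A] [Nonempty A] in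
lemma length_feedback (m : ℕ) : (feedback c d fun i : Fin (m + 1) => ω i).length =
    ∑ i ∈ Finset.range (m + 1), if i + d (i + 1) = m then 1 else 0 := by
  rw [feedback, List.length_map, length_filter_eq_sum, ← Fin.sum_univ_def, Finset.sum_range]
  refine Finset.sum_congr rfl fun i _ => ?_
  simp only [decide_eq_true_eq]
  congr 1
  exact propext ⟨fun h => by omega, fun h => by omega⟩

omit [Fintype S] [Fintype A] [Nonempty A] in
lemma estimate_update {σ : OPPOState S A H} {m : ℕ} (h1 : σ.episode = m)
    (h3 : σ.received = receivedCount (fun i => d (i + 1)) m)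
    (h4 : σ.estimate = seenDelay (fun i => d (i + 1)) m) :
    σ.estimate + 1 + (((σ.episode + 1 : ℕ) : ℤ) -
      ((σ.received + (feedback c d fun i : Fin (m + 1) => ω i).length : ℕ) : ℤ)) =
      (seenDelay (fun i => d (i + 1)) (m + 1) : ℤ) := by
  have hrec := receivedCount_succ (fun i => d (i + 1)) m
  have hest := seenDelay_succ_add (fun i => d (i + 1)) m
  rw [h1, h3, h4, length_feedback c d ω m, ← hrec]
  omega

/-- No trajectory enters the counters. Phases and sets of used episodes are therefore fixed in
advance and may serve as deterministic weights in the concentration arguments. -/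
lemma runState_fields (m : ℕ) :
    (runState p s₀ c d ω m).episode = m ∧
    (runState p s₀ c d ω m).phase = phaseAt (fun i => d (i + 1)) m ∧
    (runState p s₀ c d ω m).received = receivedCount (fun i => d (i + 1)) m ∧
    (runState p s₀ c d ω m).estimate = seenDelay (fun i => d (i + 1)) m ∧
    ∀ i < m, (runState p s₀ c d ω m).played (i + 1) = runPolicy p s₀ c d ω i := by
  induction m with
  | zero =>
    refine ⟨rfl, rfl, rfl, rfl, fun i hi => absurd hi (by omega)⟩
  | succ m ih =>
    obtain ⟨h1, h2, h3, h4, h5⟩ := ih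
    have hrec := receivedCount_succ (fun i => d (i + 1)) m
    have hlen := length_feedback c d ω m
    have hest' := estimate_update c d ω h1 h3 h4
    have hplayed : ∀ i < m + 1, Function.update (runState p s₀ c d ω m).played
        ((runState p s₀ c d ω m).episode + 1) (runState p s₀ c d ω m).policy (i + 1) =
        runPolicy p s₀ c d ω i := by
      intro i hi
      rw [h1]
      rcases eq_or_ne i m with rfl | hne
      · simp [runPolicy]
      · rw [Function.update_of_ne (by omega)]
        exact h5 i (by omega)
    rw [runState_succ]
    simp only [oppoUpdate]
    rw [hest', h2]
    have hcond : ((2 : ℤ) ^ phaseAt (fun i => d (i + 1)) m <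
        (seenDelay (fun i => d (i + 1)) (m + 1) : ℤ)) ↔
        2 ^ phaseAt (fun i => d (i + 1)) m < seenDelay (fun i => d (i + 1)) (m + 1) := by
      exact_mod_cast Iff.rfl
    split_ifs with hif
    · refine ⟨by simp [h1], ?_, ?_, rfl, hplayed⟩
      · rw [phaseAt, if_pos (hcond.1 hif)]
      · simp only; rw [h3, hlen, hrec]
    · refine ⟨by simp [h1], ?_, ?_, rfl, hplayed⟩
      · rw [phaseAt, if_neg fun h => hif (hcond.2 h)]
      · simp only; rw [h3, hlen, hrec]

open Classical in
/-- The played policies are Gibbs distributions of the losses used since the start of the phase. -/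
lemma toReal_runPolicy (m : ℕ) (h : Fin H) (s : S) (a : A) :
    (runPolicy p s₀ c d ω m h s a).toReal = gibbs (fun a =>
      learningRate H (phaseAt (fun i => d (i + 1)) m) * ∑ i ∈ Finset.range m,
        if i + d (i + 1) < m ∧ UsedIn (fun i => d (i + 1)) (phaseAt (fun i => d (i + 1)) m) i
        then estimatedQ p s₀ c d ω (phaseAt (fun i => d (i + 1)) m) i h s a else 0) a := by
  induction m generalizing a with
  | zero =>
    simp only [Finset.range_zero, Finset.sum_empty, mul_zero]
    exact toReal_uniform a
  | succ m ih =>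
    set D : ℕ → ℕ := fun i => d (i + 1) with hD
    obtain ⟨h1, h2, h3, h4, h5⟩ := runState_fields p s₀ c d ω m
    obtain ⟨-, -, -, -, g5⟩ := runState_fields p s₀ c d ω (m + 1)
    have hest := estimate_update c d ω h1 h3 h4
    by_cases hif : 2 ^ phaseAt D m < seenDelay D (m + 1)
    · have hph : phaseAt D (m + 1) = phaseAt D m + 1 := by rw [phaseAt, if_pos hif]
      -- After a reset nothing counts: all feedback so far arrived in an earlier phase, including
      -- that of episode m itself, which the reset discards.
      have hz : ∀ a, ∑ i ∈ Finset.range (m + 1),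
          (if i + d (i + 1) < m + 1 ∧ UsedIn D (phaseAt D (m + 1)) i
          then estimatedQ p s₀ c d ω (phaseAt D (m + 1)) i h s a else 0) = 0 := by
        intro a
        refine Finset.sum_eq_zero fun i _ => if_neg ?_
        rintro ⟨hi, hu, -⟩
        have := phaseAt_mono D (show i + D i ≤ m by simp only [hD]; omega)
        omega
      have hpol : runPolicy p s₀ c d ω (m + 1) h s = PMF.uniformOfFintype A := by
        rw [runPolicy, runState_succ]
        simp only [oppoUpdate]
        rw [hest, h2, if_pos (by exact_mod_cast hif)]
        rfl
      rw [hpol, toReal_uniform]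
      simp only [hz, mul_zero]
    · have hph : phaseAt D (m + 1) = phaseAt D m := by rw [phaseAt, if_neg hif]
      rw [hph]
      have hpol : runPolicy p s₀ c d ω (m + 1) h s = expWeights (runPolicy p s₀ c d ω m h s)
          (fun a => learningRate H (phaseAt D m) * ∑ i ∈ Finset.range (m + 1),
            if i + d (i + 1) = m ∧ (D i : ℝ) ≤ skipThreshold (phaseAt D m)
            then estimatedQ p s₀ c d ω (phaseAt D m) i h s a else 0) := by
        -- Feedback with delay zero refers to the policy of episode m, so the record read here must
        -- be the one already updated.
        have hpl : (runState p s₀ c d ω (m + 1)).played =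
            Function.update (runState p s₀ c d ω m).played
              ((runState p s₀ c d ω m).episode + 1) (runState p s₀ c d ω m).policy := by
          rw [runState_succ]
          simp only [oppoUpdate]
          split_ifs <;> rfl
        rw [runPolicy, runState_succ]
        simp only [oppoUpdate]
        rw [hest, h2, if_neg (by exact_mod_cast hif)]
        simp only [← hpl]
        congr 1
        funext a
        congr 1
        rw [sum_map_filter, feedback, List.map_map, sum_map_filter, ← Fin.sum_univ_def,
          Finset.sum_range]
        refine Finset.sum_congr rfl fun i _ => ?_
        have hi : (i : ℕ) < m + 1 := i.isLt
        rw [estimatedQ, ← g5 i hi]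
        simp only [decide_eq_true_eq, Function.comp_apply, h1]
        have e1 : (i : ℕ) + 1 + d (i + 1) = m + 1 ↔ (i : ℕ) + d (i + 1) = m := by omega
        by_cases k1 : (i : ℕ) + d (i + 1) = m
        · have e2 : ((m + 1 : ℕ) : ℝ) - (((i : ℕ) + 1 : ℕ) : ℝ) = (D i : ℝ) := by
            have : (m : ℝ) = (i : ℕ) + d (i + 1) := by exact_mod_cast k1.symm
            simp only [hD]
            push_cast
            linarith
          rw [if_pos (e1.2 k1), e2]
          by_cases k2 : (D i : ℝ) ≤ skipThreshold (phaseAt D m)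
          · rw [if_pos k2, if_pos ⟨k1, k2⟩]
            rfl
          · rw [if_neg k2, if_neg fun h => k2 h.2]
        · rw [if_neg fun h => k1 (e1.1 h), if_neg fun h => k1 h.1]
      rw [hpol, toReal_expWeights _ _ _ ih]
      congr 1
      funext a
      rw [← mul_add]
      congr 1
      have : ∑ i ∈ Finset.range m, (if i + d (i + 1) < m ∧ UsedIn D (phaseAt D m) i
          then estimatedQ p s₀ c d ω (phaseAt D m) i h s a else 0) =
          ∑ i ∈ Finset.range (m + 1), (if i + d (i + 1) < m ∧ UsedIn D (phaseAt D m) i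
          then estimatedQ p s₀ c d ω (phaseAt D m) i h s a else 0) := by
        rw [Finset.sum_range_succ, if_neg (fun h => by omega), add_zero]
      rw [this, ← Finset.sum_add_distrib]
      refine Finset.sum_congr rfl fun i _ => ?_
      rcases lt_trichotomy (i + d (i + 1)) m with hlt | heq | hgt
      · have h1 : i + d (i + 1) < m + 1 := by omega
        simp [hlt, h1, hlt.ne]
      · have : UsedIn D (phaseAt D m) i ↔ (D i : ℝ) ≤ skipThreshold (phaseAt D m) := by
          rw [UsedIn]
          have : i + D i = m := heq
          rw [this]; simp
        simp [heq, this]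
      · have h1 : ¬ i + d (i + 1) < m + 1 := by omega
        have h2 : ¬ i + d (i + 1) < m := by omega
        simp [h1, h2, hgt.ne']

end Run

/-! ### Exponential weights with delayed losses -/

section Hedge

variable {A : Type*} [Fintype A]

/-- Exponential weights with delayed feedback: the losses `ℓ i`, `i ∈ U`, are used at the end of
round `t i`, and the loss `ℓ j`, `j ∈ G`, is charged to the distribution of round `j`. -/
lemma gibbs_delayed_regret [Nonempty A] (n : ℕ) (U G : Finset ℕ) (t : ℕ → ℕ) (ℓ : ℕ → A → ℝ)
    (hℓ : ∀ i ∈ U, ∀ a, 0 ≤ ℓ i a) {η : ℝ} (hη : 0 < η) (hU : ∀ i ∈ U, t i < n) (hGU : G ⊆ U)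
    (hG : ∀ j ∈ G, j ≤ t j) (w : ℕ → A → ℝ)
    (hw : ∀ j ∈ G, w j = gibbs fun a => η * ∑ i ∈ U with t i < j, ℓ i a)
    (q : A → ℝ) (hq0 : ∀ a, 0 ≤ q a) (hq1 : ∑ a, q a = 1) :
    ∑ j ∈ G, ∑ a, w j a * ℓ j a ≤ Real.log (Fintype.card A) / η +
      ∑ i ∈ U, ∑ a, q a * ℓ i a +
      η * ∑ j ∈ G, ∑ a, w j a * (ℓ j a * ∑ i ∈ U with j ≤ t i ∧ t i ≤ t j, ℓ i a) := by
  set L : ℕ → A → ℝ := fun m a => η * ∑ i ∈ U with t i < m, ℓ i a with hL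
  set Z : ℕ → ℝ := fun m => ∑ a, Real.exp (-L m a) with hZ
  have hZpos : ∀ m, 0 < Z m := fun m =>
    Finset.sum_pos (fun _ _ => Real.exp_pos _) Finset.univ_nonempty
  have hLmono : ∀ a, Monotone fun m => L m a := by
    intro a m m' hmm
    refine mul_le_mul_of_nonneg_left (Finset.sum_le_sum_of_subset_of_nonneg ?_ ?_) hη.le
    · intro i hi
      simp only [Finset.mem_filter] at hi ⊢
      exact ⟨hi.1, by omega⟩
    · intro i hi _
      exact hℓ i (Finset.mem_filter.1 hi).1 a
  have hZmono : Antitone Z := fun m m' hmm => Finset.sum_le_sum fun a _ =>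
    Real.exp_le_exp.2 (neg_le_neg (hLmono a hmm))
  -- increments of the cumulative loss
  have hLstep : ∀ m a, L (m + 1) a - L m a = η * ∑ i ∈ U with t i = m, ℓ i a := by
    intro m a
    have : (U.filter fun i => t i < m + 1) =
        (U.filter fun i => t i < m) ∪ U.filter fun i => t i = m := by
      ext i; simp only [Finset.mem_filter, Finset.mem_union]
      constructor
      · rintro ⟨h1, h2⟩
        rcases Nat.lt_succ_iff_lt_or_eq.1 h2 with h | h
        · exact Or.inl ⟨h1, h⟩
        · exact Or.inr ⟨h1, h⟩
      · rintro (⟨h1, h2⟩ | ⟨h1, h2⟩) <;> exact ⟨h1, by omega⟩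
    simp only [hL]
    rw [this, Finset.sum_union]
    · ring
    · rw [Finset.disjoint_filter]
      intro i _ h1 h2
      omega
  -- The potential log Z falls by at least the losses used at round m, weighted at the updated
  -- cumulative loss. Only 1 + y ≤ exp y is applied, so no smallness of η times a loss is needed.
  have hstep : ∀ m, Real.log (Z (m + 1)) - Real.log (Z m) ≤
      -(η * ∑ j ∈ G with t j = m, ∑ a, w j a * (ℓ j a -
        η * (ℓ j a * ∑ i ∈ U with j ≤ t i ∧ t i ≤ t j, ℓ i a))) := by
    intro m
    have h1 : Real.log (Z (m + 1)) - Real.log (Z m) ≤ (Z (m + 1) - Z m) / Z m := by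
      rw [← Real.log_div (hZpos _).ne' (hZpos _).ne', sub_div, div_self (hZpos m).ne']
      exact Real.log_le_sub_one_of_pos (div_pos (hZpos _) (hZpos _))
    have h2 : Z (m + 1) - Z m ≤ -∑ a, Real.exp (-L (m + 1) a) * (L (m + 1) a - L m a) := by
      rw [hZ, ← Finset.sum_sub_distrib, ← Finset.sum_neg_distrib]
      refine Finset.sum_le_sum fun a _ => ?_
      have h3 : Real.exp (-L m a) = Real.exp (-L (m + 1) a) * Real.exp (L (m + 1) a - L m a) := by
        rw [← Real.exp_add]; congr 1; ring
      have h4 := Real.add_one_le_exp (L (m + 1) a - L m a)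
      rw [h3]
      nlinarith [Real.exp_pos (-L (m + 1) a)]
    refine h1.trans ((div_le_div_of_nonneg_right h2 (hZpos m).le).trans ?_)
    rw [neg_div, neg_le_neg_iff, le_div_iff₀ (hZpos m)]
    -- Losses used but not charged to a round are nonnegative and can be dropped here; they reappear
    -- only in the competitor's loss.
    have h5 : ∀ a, η * ∑ j ∈ G with t j = m, ℓ j a ≤ L (m + 1) a - L m a := by
      intro a
      rw [hLstep]
      refine mul_le_mul_of_nonneg_left (Finset.sum_le_sum_of_subset_of_nonneg
        (Finset.filter_subset_filter _ hGU) fun i hi _ => hℓ i (Finset.mem_filter.1 hi).1 a) hη.le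
    calc η * (∑ j ∈ G with t j = m, ∑ a, w j a * (ℓ j a -
          η * (ℓ j a * ∑ i ∈ U with j ≤ t i ∧ t i ≤ t j, ℓ i a))) * Z m
        = ∑ j ∈ G with t j = m, ∑ a, η * (w j a * (ℓ j a -
          η * (ℓ j a * ∑ i ∈ U with j ≤ t i ∧ t i ≤ t j, ℓ i a)) * Z m) := by
          simp only [Finset.mul_sum, Finset.sum_mul, mul_assoc]
      _ ≤ ∑ j ∈ G with t j = m, ∑ a, η * (ℓ j a * Real.exp (-L (m + 1) a)) := by
          refine Finset.sum_le_sum fun j hj => Finset.sum_le_sum fun a _ =>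
            mul_le_mul_of_nonneg_left ?_ hη.le
          obtain ⟨hjG, rfl⟩ := Finset.mem_filter.1 hj
          have hjt := hG j hjG
          have hwj : w j a = Real.exp (-L j a) / Z j := by rw [hw j hjG]; rfl
          set X := ∑ i ∈ U with j ≤ t i ∧ t i ≤ t j, ℓ i a with hX
          have hLX : L (t j + 1) a = L j a + η * X := by
            have : (U.filter fun i => t i < t j + 1) =
                (U.filter fun i => t i < j) ∪ U.filter fun i => j ≤ t i ∧ t i ≤ t j := by
              ext i; simp only [Finset.mem_filter, Finset.mem_union]
              constructor
              · rintro ⟨h1, h2⟩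
                rcases lt_or_ge (t i) j with h | h
                · exact Or.inl ⟨h1, h⟩
                · exact Or.inr ⟨h1, h, by omega⟩
              · rintro (⟨h1, h2⟩ | ⟨h1, h2⟩) <;> exact ⟨h1, by omega⟩
            simp only [hL, hX]
            rw [this, Finset.sum_union, mul_add]
            rw [Finset.disjoint_filter]
            intro i _ h1 h2
            omega
          have hl := hℓ j (hGU hjG) a
          have h6 : 1 - η * X ≤ Real.exp (-(η * X)) := by
            linarith [Real.add_one_le_exp (-(η * X))]
          have h7 : Z (t j) / Z j ≤ 1 := (div_le_one (hZpos _)).2 (hZmono hjt)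
          have h8 : 0 ≤ Z (t j) / Z j := div_nonneg (hZpos _).le (hZpos _).le
          -- The factor 1 - ηX may be negative, so it is replaced by the exponential before the
          -- ratio Z (t j) / Z j ≤ 1 is dropped.
          calc w j a * (ℓ j a - η * (ℓ j a * X)) * Z (t j)
              = ℓ j a * Real.exp (-L j a) * (1 - η * X) * (Z (t j) / Z j) := by rw [hwj]; ring
            _ ≤ ℓ j a * Real.exp (-L j a) * Real.exp (-(η * X)) * (Z (t j) / Z j) := by gcongr
            _ ≤ ℓ j a * Real.exp (-L j a) * Real.exp (-(η * X)) * 1 := by gcongr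
            _ = ℓ j a * Real.exp (-L (t j + 1) a) := by
              rw [hLX, neg_add, Real.exp_add]; ring
      _ = ∑ a, Real.exp (-L (m + 1) a) * (η * ∑ j ∈ G with t j = m, ℓ j a) := by
          rw [Finset.sum_comm]
          refine Finset.sum_congr rfl fun a _ => ?_
          rw [Finset.mul_sum, Finset.mul_sum]
          exact Finset.sum_congr rfl fun j _ => by ring
      _ ≤ _ := Finset.sum_le_sum fun a _ =>
          mul_le_mul_of_nonneg_left (h5 a) (Real.exp_pos _).le
  have htel : Real.log (Z n) - Real.log (Z 0) ≤
      -(η * ∑ j ∈ G, ∑ a, w j a * (ℓ j a -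
        η * (ℓ j a * ∑ i ∈ U with j ≤ t i ∧ t i ≤ t j, ℓ i a))) := by
    rw [← Finset.sum_range_sub (fun m => Real.log (Z m))]
    refine (Finset.sum_le_sum fun m _ => hstep m).trans_eq ?_
    rw [Finset.sum_neg_distrib, ← Finset.mul_sum]
    congr 2
    exact Finset.sum_fiberwise_of_maps_to (fun j hj => Finset.mem_range.2 (hU j (hGU hj))) _
  have hZ0 : Z 0 = Fintype.card A := by simp [hZ, hL]
  have hLn : ∀ a, L n a = η * ∑ i ∈ U, ℓ i a := by
    intro a
    simp only [hL]
    rw [Finset.filter_true_of_mem hU]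
  have hlow : -(η * ∑ i ∈ U, ∑ a, q a * ℓ i a) ≤ Real.log (Z n) := by
    have h1 : ∀ a, -L n a ≤ Real.log (Z n) := fun a => by
      rw [Real.le_log_iff_exp_le (hZpos n)]
      exact Finset.single_le_sum (f := fun a => Real.exp (-L n a))
        (fun _ _ => (Real.exp_pos _).le) (Finset.mem_univ a)
    have h2 : ∑ a, q a * (-L n a) ≤ ∑ a, q a * Real.log (Z n) :=
      Finset.sum_le_sum fun a _ => mul_le_mul_of_nonneg_left (h1 a) (hq0 a)
    rw [← Finset.sum_mul, hq1, one_mul] at h2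
    refine le_trans (le_of_eq ?_) h2
    rw [Finset.sum_comm, Finset.mul_sum, ← Finset.sum_neg_distrib]
    refine Finset.sum_congr rfl fun a _ => ?_
    rw [hLn, ← Finset.mul_sum]; ring
  have hsplit : ∑ j ∈ G, ∑ a, w j a * (ℓ j a -
        η * (ℓ j a * ∑ i ∈ U with j ≤ t i ∧ t i ≤ t j, ℓ i a)) =
      ∑ j ∈ G, ∑ a, w j a * ℓ j a -
      η * ∑ j ∈ G, ∑ a, w j a * (ℓ j a * ∑ i ∈ U with j ≤ t i ∧ t i ≤ t j, ℓ i a) := by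
    rw [Finset.mul_sum, ← Finset.sum_sub_distrib]
    refine Finset.sum_congr rfl fun j _ => ?_
    rw [Finset.mul_sum, ← Finset.sum_sub_distrib]
    exact Finset.sum_congr rfl fun a _ => by ring
  rw [hsplit, hZ0] at htel
  set X₁ := ∑ j ∈ G, ∑ a, w j a * ℓ j a
  set X₂ := η * ∑ j ∈ G, ∑ a, w j a * (ℓ j a * ∑ i ∈ U with j ≤ t i ∧ t i ≤ t j, ℓ i a)
  set X₃ := ∑ i ∈ U, ∑ a, q a * ℓ i a
  have h9 : η * (X₁ - X₂ - X₃) ≤ Real.log (Fintype.card A) := by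
    nlinarith
  have h10 : X₁ - X₂ - X₃ ≤ Real.log (Fintype.card A) / η := by
    rw [le_div_iff₀ hη]; linarith
  linarith

end Hedge

/-! ### Counting stale, overlapping and lost episodes of a phase -/

section Counting

open Classical in
/-- The episodes whose feedback is used in phase `e` before episode `K` is over. -/
noncomputable def usedSet (D : ℕ → ℕ) (K e : ℕ) : Finset ℕ :=
  {i ∈ Finset.range K | i + D i < K ∧ UsedIn D e i}

/-- The episodes of phase `e`. -/
def phaseSet (D : ℕ → ℕ) (K e : ℕ) : Finset ℕ := {i ∈ Finset.range K | phaseAt D i = e}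

/-- The episodes of phase `e` whose feedback is used in phase `e`. -/
noncomputable def goodSet (D : ℕ → ℕ) (K e : ℕ) : Finset ℕ :=
  {i ∈ usedSet D K e | phaseAt D i = e}

/-- The episodes of earlier phases whose feedback is used in phase `e`. -/
noncomputable def staleSet (D : ℕ → ℕ) (K e : ℕ) : Finset ℕ :=
  {i ∈ usedSet D K e | ¬ phaseAt D i = e}

/-- The episodes whose feedback is used in phase `e` between the episode `j` and the time when the
feedback of `j` is used. -/
noncomputable def overlapSet (D : ℕ → ℕ) (K e j : ℕ) : Finset ℕ :=
  {i ∈ usedSet D K e | j ≤ i + D i ∧ i + D i ≤ j + D j}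

variable {D : ℕ → ℕ} {K e : ℕ}

open Classical in
lemma mem_usedSet {i : ℕ} : i ∈ usedSet D K e ↔
    i + D i < K ∧ phaseAt D (i + D i) = e ∧ (D i : ℝ) ≤ skipThreshold e := by
  rw [usedSet, Finset.mem_filter, Finset.mem_range, UsedIn]
  exact ⟨fun h => h.2, fun h => ⟨by omega, h⟩⟩

lemma mem_phaseSet {i : ℕ} : i ∈ phaseSet D K e ↔ i < K ∧ phaseAt D i = e := by
  simp [phaseSet]

lemma arrival_mem_phaseSet {i : ℕ} (hi : i ∈ usedSet D K e) : i + D i ∈ phaseSet D K e := by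
  rw [mem_usedSet] at hi
  exact mem_phaseSet.2 ⟨hi.1, hi.2.1⟩

lemma goodSet_subset_usedSet : goodSet D K e ⊆ usedSet D K e := Finset.filter_subset _ _

lemma goodSet_subset_phaseSet : goodSet D K e ⊆ phaseSet D K e := by
  intro i hi
  obtain ⟨h1, h2⟩ := Finset.mem_filter.1 hi
  rw [mem_usedSet] at h1
  exact mem_phaseSet.2 ⟨by omega, h2⟩

lemma delay_le_floor {i : ℕ} (hi : i ∈ usedSet D K e) : D i ≤ ⌊skipThreshold e⌋₊ :=
  Nat.le_floor (mem_usedSet.1 hi).2.2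

lemma seenDelay_mono : Monotone (seenDelay D) := by
  intro m n hmn
  refine add_le_add hmn ((Finset.sum_le_sum fun i _ => ?_).trans
    (Finset.sum_le_sum_of_subset (Finset.range_mono hmn)))
  omega

lemma seenDelay_le (n : ℕ) : seenDelay D n ≤ n + ∑ i ∈ Finset.range n, D i :=
  Nat.add_le_add_left (Finset.sum_le_sum fun _ _ => min_le_left _ _) _

lemma seenDelay_le_sq (n : ℕ) : seenDelay D n ≤ n + n * n := by
  refine Nat.add_le_add_left ((Finset.sum_le_card_nsmul _ _ n fun i _ => ?_).trans_eq ?_) _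
  · omega
  · simp

/-- Phase e + 1 is entered only once the estimate exceeds 2^e; the summand 2 accounts for the
initial phase 1. -/
lemma two_pow_phaseAt_le (n : ℕ) : 2 ^ phaseAt D n ≤ 2 * seenDelay D n + 2 := by
  induction n with
  | zero => simp [phaseAt]
  | succ n ih =>
    have := seenDelay_mono (D := D) (Nat.le_add_right n 1)
    rw [phaseAt]
    split_ifs with h
    · rw [pow_succ]; omega
    · exact ih.trans (by omega)

/-- The test failed just before b. An earlier episode of the same phase is needed: the phase grows
by one at a time while the estimate may jump, so it can exceed 2^e on entry. -/
lemma seenDelay_le_two_pow {a b : ℕ} (hab : a < b) (ha : phaseAt D a = e) (hb : phaseAt D b = e) :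
    seenDelay D b ≤ 2 ^ e := by
  obtain ⟨m, rfl⟩ : ∃ m, b = m + 1 := ⟨b - 1, by omega⟩
  have h1 : phaseAt D m = e :=
    le_antisymm (hb ▸ phaseAt_mono D (Nat.le_succ m)) (ha ▸ phaseAt_mono D (by omega))
  rw [phaseAt, h1] at hb
  by_contra h
  rw [if_pos (by omega)] at hb
  omega

/-- Skipping limits delays to the threshold, so stale episodes lie in a window of that length just
before the phase. -/
lemma card_staleSet_le : (staleSet D K e).card ≤ ⌊skipThreshold e⌋₊ := by
  rcases (staleSet D K e).eq_empty_or_nonempty with h | ⟨i₀, hi₀⟩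
  · simp [h]
  have hne : (phaseSet D K e).Nonempty :=
    ⟨_, arrival_mem_phaseSet (Finset.mem_filter.1 hi₀).1⟩
  set a := (phaseSet D K e).min' hne
  have ha : phaseAt D a = e := (mem_phaseSet.1 ((phaseSet D K e).min'_mem hne)).2
  have hsub : staleSet D K e ⊆ Finset.Ico (a - ⌊skipThreshold e⌋₊) a := by
    intro i hi
    obtain ⟨h1, h2⟩ := Finset.mem_filter.1 hi
    have h3 := delay_le_floor h1
    have h4 : a ≤ i + D i := (phaseSet D K e).min'_le _ (arrival_mem_phaseSet h1)
    have h5 : i < a := by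
      by_contra h
      refine h2 (le_antisymm ?_ (ha ▸ phaseAt_mono D (by omega)))
      exact (mem_usedSet.1 h1).2.1 ▸ phaseAt_mono D (by omega)
    exact Finset.mem_Ico.2 ⟨by omega, h5⟩
  refine (Finset.card_le_card hsub).trans ?_
  rw [Nat.card_Ico]; omega

lemma card_overlapSet_le {j : ℕ} (hj : j ∈ usedSet D K e) :
    (overlapSet D K e j).card ≤ 2 * ⌊skipThreshold e⌋₊ + 1 := by
  have hsub : overlapSet D K e j ⊆
      Finset.Icc (j - ⌊skipThreshold e⌋₊) (j + ⌊skipThreshold e⌋₊) := by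
    intro i hi
    obtain ⟨h1, h2, h3⟩ := Finset.mem_filter.1 hi
    have h4 := delay_le_floor h1
    have h5 := delay_le_floor hj
    exact Finset.mem_Icc.2 ⟨by omega, by omega⟩
  refine (Finset.card_le_card hsub).trans ?_
  rw [Nat.card_Icc]; omega

/-- Charge a pair i < j to i, since then j lies in (i, i + D i], and a pair i > j to j, since then i
lies in (j, j + D j]. The pairs i = j give the first summand. -/
lemma sum_card_overlapSet_le : ∑ j ∈ goodSet D K e, (overlapSet D K e j).card ≤
    (goodSet D K e).card + 2 * ∑ i ∈ usedSet D K e, D i := by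
  have h1 : ∀ j ∈ goodSet D K e, (overlapSet D K e j).card ≤
      1 + ∑ i ∈ usedSet D K e, (if i < j ∧ j ≤ i + D i then 1 else 0) + D j := by
    intro j hj
    have hsub : overlapSet D K e j ⊆
        {j} ∪ {i ∈ usedSet D K e | i < j ∧ j ≤ i + D i} ∪ Finset.Ioc j (j + D j) := by
      intro i hi
      obtain ⟨h1, h2, h3⟩ := Finset.mem_filter.1 hi
      simp only [Finset.mem_union, Finset.mem_singleton, Finset.mem_filter, Finset.mem_Ioc]
      rcases lt_trichotomy i j with h | h | h
      · exact Or.inl (Or.inr ⟨h1, h, h2⟩)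
      · exact Or.inl (Or.inl h)
      · exact Or.inr ⟨h, by omega⟩
    refine (Finset.card_le_card hsub).trans ((Finset.card_union_le _ _).trans ?_)
    refine add_le_add ((Finset.card_union_le _ _).trans ?_) (by simp)
    rw [Finset.card_singleton, Finset.card_filter]
  refine (Finset.sum_le_sum h1).trans ?_
  rw [Finset.sum_add_distrib, Finset.sum_add_distrib, Finset.sum_comm]
  have h2 : ∑ i ∈ usedSet D K e, ∑ j ∈ goodSet D K e,
      (if i < j ∧ j ≤ i + D i then 1 else 0) ≤ ∑ i ∈ usedSet D K e, D i := by
    refine Finset.sum_le_sum fun i _ => ?_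
    rw [← Finset.card_filter]
    calc _ ≤ (Finset.Ioc i (i + D i)).card := Finset.card_le_card fun j hj => by
            obtain ⟨-, h⟩ := Finset.mem_filter.1 hj
            exact Finset.mem_Ioc.2 h
      _ = D i := by simp
  have h3 : ∑ j ∈ goodSet D K e, D j ≤ ∑ i ∈ usedSet D K e, D i :=
    Finset.sum_le_sum_of_subset goodSet_subset_usedSet
  simp only [Finset.sum_const, smul_eq_mul, mul_one]
  omega

section Long

variable {b : ℕ} (hb : b ∈ phaseSet D K e) (hmax : ∀ i ∈ phaseSet D K e, i ≤ b)
  (hseen : seenDelay D b ≤ 2 ^ e)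
include hmax hseen

lemma card_phaseSet_le : (phaseSet D K e).card ≤ 2 ^ e + 1 := by
  have hsub : phaseSet D K e ⊆ Finset.range (b + 1) := fun i hi =>
    Finset.mem_range.2 (Nat.lt_succ_of_le (hmax i hi))
  have := Finset.card_le_card hsub
  rw [Finset.card_range] at this
  have h2 : b ≤ seenDelay D b := Nat.le_add_right _ _
  omega

/-- Used feedback arrives no later than episode b, so the estimate counts its delay in full. -/
lemma sum_delay_usedSet_le : ∑ i ∈ usedSet D K e, D i ≤ 2 ^ e := by
  refine le_trans ?_ hseen
  have hsub : usedSet D K e ⊆ Finset.range (b + 1) := fun i hi => by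
    have := hmax _ (arrival_mem_phaseSet hi)
    exact Finset.mem_range.2 (by omega)
  calc ∑ i ∈ usedSet D K e, D i ≤ ∑ i ∈ usedSet D K e, min (D i) (b - i) :=
        Finset.sum_le_sum fun i hi => by
          have := hmax _ (arrival_mem_phaseSet hi)
          omega
    _ ≤ ∑ i ∈ Finset.range (b + 1), min (D i) (b - i) := Finset.sum_le_sum_of_subset hsub
    _ ≤ seenDelay D b := by
        rw [Finset.sum_range_succ, seenDelay]
        omega

-- An episode that is not good is either among the last ones of the phase or has a delay above the
-- threshold. One of the latter kind lying far enough before b adds more than the threshold to the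
-- estimate, which is at most 2^e.
include hb in
lemma card_phaseSet_sdiff_goodSet_le : ((phaseSet D K e \ goodSet D K e).card : ℝ) ≤
    skipThreshold e + 1 + 2 ^ e / skipThreshold e := by
  set N := ⌊skipThreshold e⌋₊ with hN
  have hpos : 0 < skipThreshold e := Real.rpow_pos_of_pos two_pos _
  obtain ⟨hbK, hbe⟩ := mem_phaseSet.1 hb
  set T := {j ∈ phaseSet D K e | N + 1 ≤ D j ∧ j + N + 1 ≤ b} with hT
  have hsub : phaseSet D K e \ goodSet D K e ⊆ Finset.Icc (b - N) b ∪ T := by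
    intro j hj
    obtain ⟨hj1, hj2⟩ := Finset.mem_sdiff.1 hj
    have hjb := hmax j hj1
    obtain ⟨hjK, hje⟩ := mem_phaseSet.1 hj1
    rw [Finset.mem_union]
    by_cases h1 : j + N + 1 ≤ b
    · refine Or.inr (Finset.mem_filter.2 ⟨hj1, ?_, h1⟩)
      by_contra h2
      have h3 : phaseAt D (j + D j) = e :=
        le_antisymm (hbe ▸ phaseAt_mono D (by omega)) (hje ▸ phaseAt_mono D (by omega))
      refine hj2 (Finset.mem_filter.2 ⟨mem_usedSet.2 ⟨by omega, h3, ?_⟩, hje⟩)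
      exact (Nat.le_floor_iff hpos.le).1 (by omega)
    · exact Or.inl (Finset.mem_Icc.2 ⟨by omega, hjb⟩)
  have hcard : (phaseSet D K e \ goodSet D K e).card ≤ N + 1 + T.card := by
    refine (Finset.card_le_card hsub).trans ((Finset.card_union_le _ _).trans ?_)
    rw [Nat.card_Icc]
    omega
  have hTcard : T.card * (N + 1) ≤ 2 ^ e := by
    have hTsub : T ⊆ Finset.range b := fun j hj => by
      have := (Finset.mem_filter.1 hj).2
      exact Finset.mem_range.2 (by omega)
    calc T.card * (N + 1) ≤ ∑ j ∈ T, min (D j) (b - j) := by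
          rw [← smul_eq_mul]
          refine Finset.card_nsmul_le_sum _ _ _ fun j hj => ?_
          have := (Finset.mem_filter.1 hj).2
          omega
      _ ≤ ∑ j ∈ Finset.range b, min (D j) (b - j) := Finset.sum_le_sum_of_subset hTsub
      _ ≤ 2 ^ e := le_trans (Nat.le_add_left _ _) hseen
  have h1 : (T.card : ℝ) ≤ 2 ^ e / skipThreshold e := by
    rw [le_div_iff₀ hpos]
    have h2 : (T.card : ℝ) * (N + 1) ≤ 2 ^ e := by exact_mod_cast hTcard
    refine le_trans (mul_le_mul_of_nonneg_left ?_ (Nat.cast_nonneg _)) h2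
    exact (Nat.lt_floor_add_one _).le
  have h2 : (N : ℝ) ≤ skipThreshold e := Nat.floor_le hpos.le
  have h3 : ((phaseSet D K e \ goodSet D K e).card : ℝ) ≤ N + 1 + T.card := by
    exact_mod_cast hcard
  linarith

end Long

end Counting

/-! ### Exponential moments along the interaction -/

section Interaction

variable {S : Type u} {A : Type v} [Fintype S] [Fintype A] {H : ℕ}

/-- Exponential supermartingales along the interaction. -/
lemma expect_interactionLaw_exp_sum_le_one (L : Learner S A H) (p : Transition S A H) (s₀ : S)
    (c : ℕ → CostFn S A H) (d : ℕ → ℕ) (K : ℕ) (f : ℕ → Policy S A H → Trajectory S A H → ℝ)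
    (hf : ∀ k < K, ∀ π, expect (trajectoryLaw p π s₀) (fun x => Real.exp (f k π x)) ≤ 1) :
    expect (interactionLaw L p s₀ c d K) (fun u =>
      Real.exp (∑ k : Fin K, f k (playedPolicy L c d u k) (u k))) ≤ 1 := by
  induction K with
  | zero => simp [interactionLaw, expect_pure]
  | succ K ih =>
    -- Earlier policies do not see the appended trajectory, so the exponent splits into the old sum
    -- and one new term.
    have h1 : ∀ (u : Fin K → Trajectory S A H) (x : Trajectory S A H),
        ∑ k : Fin (K + 1), f k (playedPolicy L c d
          (Fin.snoc (α := fun _ => Trajectory S A H) u x) k)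
          (Fin.snoc (α := fun _ => Trajectory S A H) u x k) =
        ∑ k : Fin K, f k (playedPolicy L c d u k) (u k) +
          f K (L.policy (stateAfter L c d u)) x := by
      intro u x
      rw [Fin.sum_univ_castSucc]
      congr 1
      · refine Finset.sum_congr rfl fun k _ => ?_
        rw [Fin.snoc_castSucc]
        congr 1
        simp only [playedPolicy]
        congr 2
        funext i
        exact Fin.snoc_castSucc (α := fun _ => Trajectory S A H) x u (Fin.castLE k.isLt.le i)
      · rw [Fin.snoc_last]
        congr 1
        simp only [playedPolicy]
        congr 2
        funext i
        exact Fin.snoc_castSucc (α := fun _ => Trajectory S A H) x u i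
    simp only [interactionLaw, expect_bind, expect_map, h1, Real.exp_add, expect_const_mul]
    refine le_trans (expect_mono _ fun u => ?_) (ih fun k hk => hf k (by omega))
    exact mul_le_of_le_one_right (Real.exp_pos _).le (hf K (by omega) _)

variable [Nonempty A]

/-- Extension of a history to an infinite sequence of trajectories. -/
noncomputable def extendHistory (s₀ : S) {K : ℕ} (u : Fin K → Trajectory S A H) (i : ℕ) :
    Trajectory S A H :=
  if h : i < K then u ⟨i, h⟩ else fun _ => (s₀, Classical.arbitrary A)

lemma playedPolicy_eq_runPolicy (p : Transition S A H) (s₀ : S) (c : ℕ → CostFn S A H) (d : ℕ → ℕ)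
    {K : ℕ} (u : Fin K → Trajectory S A H) (k : Fin K) :
    playedPolicy (doublingOPPO p s₀) c d u k = runPolicy p s₀ c d (extendHistory s₀ u) k := by
  simp only [playedPolicy, runPolicy, runState]
  have : Fin.take (k : ℕ) k.isLt.le u = fun i : Fin k => extendHistory s₀ u i := by
    funext i
    rw [extendHistory, dif_pos (i.isLt.trans k.isLt)]
    rfl
  rw [this]
  rfl

omit [Fintype S] [Fintype A] in
lemma extendHistory_apply (s₀ : S) {K : ℕ} (u : Fin K → Trajectory S A H) (k : Fin K) :
    extendHistory s₀ u k = u k := by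
  rw [extendHistory, dif_pos k.isLt]

end Interaction

/-- All parameters of phase `e` are powers of `2 ^ (e / 6)`. -/
noncomputable def phaseScale (e : ℕ) : ℝ := (2 : ℝ) ^ ((e : ℝ) / 6)

lemma one_le_phaseScale (e : ℕ) : 1 ≤ phaseScale e :=
  Real.one_le_rpow one_le_two (by positivity)

lemma phaseScale_pos (e : ℕ) : 0 < phaseScale e := Real.rpow_pos_of_pos two_pos _

lemma phaseScale_pow (e n : ℕ) : phaseScale e ^ n = (2 : ℝ) ^ ((e : ℝ) / 6 * n) := by
  rw [phaseScale, ← Real.rpow_natCast, ← Real.rpow_mul two_pos.le]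

lemma phaseScale_pow_six (e : ℕ) : phaseScale e ^ 6 = 2 ^ e := by
  rw [phaseScale_pow, ← Real.rpow_natCast]
  congr 1; push_cast; ring

lemma skipThreshold_eq (e : ℕ) : skipThreshold e = phaseScale e ^ 3 := by
  rw [phaseScale_pow, skipThreshold]
  congr 1; push_cast; ring

lemma explorationParam_eq (e : ℕ) : explorationParam e = (phaseScale e ^ 2)⁻¹ := by
  rw [phaseScale_pow, explorationParam, ← Real.rpow_neg two_pos.le]
  congr 1; push_cast; ring

lemma learningRate_eq (H e : ℕ) : learningRate H e = (H : ℝ)⁻¹ * (phaseScale e ^ 4)⁻¹ := by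
  rw [phaseScale_pow, learningRate, ← Real.rpow_neg two_pos.le]
  congr 2; push_cast; ring

lemma explorationParam_pos (e : ℕ) : 0 < explorationParam e := Real.rpow_pos_of_pos two_pos _

/-! ### Exponential weights within one phase -/

section Phase

variable {S : Type u} {A : Type v} [Fintype S] [Fintype A] [Nonempty A] {H : ℕ}
  (p : Transition S A H) (s₀ : S) (c : ℕ → CostFn S A H) (d : ℕ → ℕ) (ω : ℕ → Trajectory S A H)
  {K e : ℕ}

/-- The cost estimates computed in phase `e` from the feedback of episode `i`. -/
noncomputable def runEstimate (e i : ℕ) : CostFn S A H :=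
  estimatedCost p s₀ (explorationParam e) (c (i + 1)) (runPolicy p s₀ c d ω i) (ω i)

/-- `usedSet` also contains the feedback that a reset at the end of the phase discards. This is
harmless, as no policy of the phase would have seen it. -/
lemma toReal_runPolicy_of_phase {j : ℕ} (hj : j ∈ phaseSet (fun i => d (i + 1)) K e) (h : Fin H)
    (s : S) : (fun a => (runPolicy p s₀ c d ω j h s a).toReal) =
      gibbs fun a => learningRate H e *
        ∑ i ∈ usedSet (fun i => d (i + 1)) K e with i + d (i + 1) < j,
          estimatedQ p s₀ c d ω e i h s a := by
  classical
  obtain ⟨hjK, hje⟩ := mem_phaseSet.1 hj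
  funext a
  rw [toReal_runPolicy]
  refine congrFun (congrArg _ (funext fun a => ?_)) a
  rw [hje, ← Finset.sum_filter]
  congr 1
  refine Finset.sum_congr ?_ fun _ _ => rfl
  ext i
  rw [Finset.mem_filter, Finset.mem_filter, mem_usedSet, Finset.mem_range, UsedIn]
  constructor
  · rintro ⟨h1, h2, h3, h4⟩
    exact ⟨⟨by omega, h3, h4⟩, h2⟩
  · rintro ⟨⟨h1, h2, h3⟩, h4⟩
    exact ⟨by omega, h4, h2, h3⟩

variable (hc : ∀ i < K, ∀ h s a, c (i + 1) h s a ∈ Set.Icc (0 : ℝ) 1)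
include hc

omit [Fintype S] [Fintype A] [Nonempty A] in
lemma cost_mem_of_mem_usedSet {i : ℕ} (hi : i ∈ usedSet (fun i => d (i + 1)) K e) :
    ∀ h s a, c (i + 1) h s a ∈ Set.Icc (0 : ℝ) 1 :=
  hc i (by have := (mem_usedSet.1 hi).1; omega)

/-- The competitor's loss on used feedback splits into a good part, compared with the learner's, and
a stale part, to which no round of this phase corresponds. -/
lemma hedge_phase (hH : 0 < H) (π' : Policy S A H) (h : Fin H) (s : S) :
    ∑ j ∈ goodSet (fun i => d (i + 1)) K e,
      (expect (runPolicy p s₀ c d ω j h s) (fun a => estimatedQ p s₀ c d ω e j h s a) -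
        expect (π' h s) (fun a => estimatedQ p s₀ c d ω e j h s a)) ≤
    Real.log (Fintype.card A) / learningRate H e +
      expect (π' h s) (fun a => ∑ i ∈ staleSet (fun i => d (i + 1)) K e,
        estimatedQ p s₀ c d ω e i h s a) +
      learningRate H e * ∑ j ∈ goodSet (fun i => d (i + 1)) K e,
        expect (runPolicy p s₀ c d ω j h s) (fun a => estimatedQ p s₀ c d ω e j h s a *
          ∑ i ∈ overlapSet (fun i => d (i + 1)) K e j, estimatedQ p s₀ c d ω e i h s a) := by
  have hη : 0 < learningRate H e := by
    have := phaseScale_pos e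
    rw [learningRate_eq]; positivity
  have key := gibbs_delayed_regret K (usedSet (fun i => d (i + 1)) K e)
    (goodSet (fun i => d (i + 1)) K e) (fun i => i + d (i + 1))
    (fun i a => estimatedQ p s₀ c d ω e i h s a)
    (fun i hi a => evalQ_estimatedCost_nonneg p s₀ (explorationParam_pos e)
      (cost_mem_of_mem_usedSet c d hc hi) _ _ h s a) hη
    (fun i hi => (mem_usedSet.1 hi).1) goodSet_subset_usedSet (fun j _ => Nat.le_add_right _ _)
    (fun j a => (runPolicy p s₀ c d ω j h s a).toReal)
    (fun j hj => toReal_runPolicy_of_phase p s₀ c d ω (goodSet_subset_phaseSet hj) h s)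
    (fun a => (π' h s a).toReal) (fun a => ENNReal.toReal_nonneg) (sum_toReal_eq_one _)
  have hsplit := Finset.sum_filter_add_sum_filter_not (usedSet (fun i => d (i + 1)) K e)
    (fun i => phaseAt (fun i => d (i + 1)) i = e)
    (fun i => ∑ a, (π' h s a).toReal * estimatedQ p s₀ c d ω e i h s a)
  rw [← hsplit] at key
  rw [expect_sum, Finset.sum_sub_distrib]
  simp only [expect]
  simp only [goodSet, staleSet, overlapSet] at key ⊢
  linarith

/-- The deviation bounds under which the regret of phase `e` is controlled. -/
structure PhaseEvent (K e : ℕ) (b : ℝ) : Prop where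
  value : ∑ j ∈ goodSet (fun i => d (i + 1)) K e,
    (explorationParam e / H * ((value p (runPolicy p s₀ c d ω j) (c (j + 1)) s₀ -
      explorationParam e * (H * Fintype.card S * Fintype.card A)) -
      value p (runPolicy p s₀ c d ω j) (runEstimate p s₀ c d ω e j) s₀) -
      (explorationParam e / H * H) ^ 2) ≤ b
  cost : ∀ h s a, ∑ j ∈ goodSet (fun i => d (i + 1)) K e,
    explorationParam e * (runEstimate p s₀ c d ω e j h s a - c (j + 1) h s a) ≤ b
  stale : ∀ h s a, ∑ i ∈ staleSet (fun i => d (i + 1)) K e,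
    (estimatedQ p s₀ c d ω e i h s a - 2 * H) / (H / explorationParam e) ≤ b
  overlap : ∀ j ∈ goodSet (fun i => d (i + 1)) K e, ∀ h s a,
    ∑ i ∈ overlapSet (fun i => d (i + 1)) K e j,
      (estimatedQ p s₀ c d ω e i h s a - 2 * H) / (H / explorationParam e) ≤ b
  weighted : ∀ h s, ∑ j ∈ goodSet (fun i => d (i + 1)) K e,
    ((2 * (overlapSet (fun i => d (i + 1)) K e j).card + b / explorationParam e) *
      expect (runPolicy p s₀ c d ω j h s) (fun a => estimatedQ p s₀ c d ω e j h s a) -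
      2 * ((2 * (overlapSet (fun i => d (i + 1)) K e j).card + b / explorationParam e) * H)) /
      ((4 * skipThreshold e + 2 + b / explorationParam e) * (H / explorationParam e)) ≤ b

/-- The drift term is a product of two random factors. The overlap sum is bounded first, uniformly
in the action, by H(2|overlap| + b/γ). The remaining factor is then summed with these deterministic
weights, to which `PhaseEvent.weighted` is tailored. -/
lemma hedge_phase_le (hH : 0 < H) {b : ℝ} (hb : 1 ≤ b) (hE : PhaseEvent p s₀ c d ω K e b)
    (π' : Policy S A H) (h : Fin H) (s : S) :
    ∑ j ∈ goodSet (fun i => d (i + 1)) K e,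
      (expect (runPolicy p s₀ c d ω j h s) (fun a => estimatedQ p s₀ c d ω e j h s a) -
        expect (π' h s) (fun a => estimatedQ p s₀ c d ω e j h s a)) ≤
    Real.log (Fintype.card A) / learningRate H e +
      (2 * H * (staleSet (fun i => d (i + 1)) K e).card + b * (H / explorationParam e)) +
      learningRate H e * (H * (2 * H * ∑ j ∈ goodSet (fun i => d (i + 1)) K e,
          (2 * (overlapSet (fun i => d (i + 1)) K e j).card + b / explorationParam e) +
        b * ((4 * skipThreshold e + 2 + b / explorationParam e) * (H / explorationParam e)))) := by
  have hγ := explorationParam_pos e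
  have hH' : (0 : ℝ) < H := by exact_mod_cast hH
  have hη : 0 < learningRate H e := by
    have := phaseScale_pos e
    rw [learningRate_eq]; positivity
  have hβ : 0 < skipThreshold e := Real.rpow_pos_of_pos two_pos _
  have hset : ∀ (I : Finset ℕ) (h : Fin H) (s : S) (a : A),
      ∑ i ∈ I, (estimatedQ p s₀ c d ω e i h s a - 2 * H) / (H / explorationParam e) ≤ b →
      ∑ i ∈ I, estimatedQ p s₀ c d ω e i h s a ≤ 2 * H * I.card + b * (H / explorationParam e) := by
    intro I h s a hI
    rw [← Finset.sum_div, div_le_iff₀ (by positivity), Finset.sum_sub_distrib, Finset.sum_const,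
      nsmul_eq_mul] at hI
    linarith
  refine (hedge_phase p s₀ c d ω hc hH π' h s).trans ?_
  refine add_le_add (add_le_add le_rfl ?_) (mul_le_mul_of_nonneg_left ?_ hη.le)
  · exact expect_le_of_le _ fun a => hset _ h s a (hE.stale h s a)
  · have hw := hE.weighted h s
    rw [← Finset.sum_div, div_le_iff₀ (by positivity), Finset.sum_sub_distrib, ← Finset.mul_sum,
      ← Finset.sum_mul] at hw
    have h1 : ∀ j ∈ goodSet (fun i => d (i + 1)) K e,
        expect (runPolicy p s₀ c d ω j h s) (fun a => estimatedQ p s₀ c d ω e j h s a *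
          ∑ i ∈ overlapSet (fun i => d (i + 1)) K e j, estimatedQ p s₀ c d ω e i h s a) ≤
        H * ((2 * (overlapSet (fun i => d (i + 1)) K e j).card + b / explorationParam e) *
      expect (runPolicy p s₀ c d ω j h s) (fun a => estimatedQ p s₀ c d ω e j h s a)) := by
      intro j hj
      rw [← expect_const_mul, ← expect_const_mul]
      refine expect_mono _ fun a => ?_
      have h2 := hset _ h s a (hE.overlap j hj h s a)
      have h3 : 0 ≤ estimatedQ p s₀ c d ω e j h s a :=
        evalQ_estimatedCost_nonneg p s₀ hγ
          (cost_mem_of_mem_usedSet c d hc (goodSet_subset_usedSet hj)) _ _ h s a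
      refine (mul_le_mul_of_nonneg_left h2 h3).trans_eq ?_
      ring
    refine (Finset.sum_le_sum h1).trans ?_
    rw [← Finset.mul_sum]
    refine mul_le_mul_of_nonneg_left ?_ hH'.le
    linarith

end Phase

/-! ### The regret of one phase -/

section PhaseRegret

variable {S : Type u} {A : Type v} [Fintype S] [Fintype A] [Nonempty A] {H : ℕ}
  (p : Transition S A H) (s₀ : S) (c : ℕ → CostFn S A H) (d : ℕ → ℕ) (ω : ℕ → Trajectory S A H)
  {K e : ℕ}

omit [Nonempty A] in
lemma value_sub_value_le (π π' : Policy S A H) {c : CostFn S A H}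
    (hc : ∀ h s a, c h s a ∈ Set.Icc (0 : ℝ) 1) :
    value p π c s₀ - value p π' c s₀ ≤ H := by
  rw [value_eq_evalV, value_eq_evalV]
  have h1 := evalV_le p π c (fun h s a => (hc h s a).2) s₀
  have h2 := evalV_nonneg p π' c (fun h s a => (hc h s a).1) s₀
  linarith

/-- Numerical form of the bound in `hedge_phase_le`. -/
lemma hedge_bound_le {H x b l n g N σ : ℝ} (hH : 1 ≤ H) (hx : 1 ≤ x) (hb : 1 ≤ b) (hl : l ≤ b)
    (hn : n ≤ x ^ 3) (hg : g ≤ 2 * x ^ 6) (hN : N ≤ g + 2 * x ^ 6)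
    (hσ : σ = 2 * N + g * (b * x ^ 2)) :
    l * (H * x ^ 4) + (2 * H * n + b * (H * x ^ 2)) +
      H⁻¹ * (x ^ 4)⁻¹ * (H * (2 * H * σ +
        b * ((4 * x ^ 3 + 2 + b * x ^ 2) * (H * x ^ 2)))) ≤ 31 * (H * x ^ 4 * b ^ 2) := by
  have hx0 : 0 < x := by linarith
  have hH0 : 0 < H := by linarith
  have hb0 : 0 < b := by linarith
  have hbb : b ≤ b ^ 2 := by nlinarith
  have x3 : (1 : ℝ) ≤ x ^ 3 := one_le_pow₀ hx
  have p34 : x ^ 3 ≤ x ^ 4 := pow_le_pow_right₀ hx (by norm_num)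
  have p24 : x ^ 2 ≤ x ^ 4 := pow_le_pow_right₀ hx (by norm_num)
  have p23 : x ^ 2 ≤ x ^ 3 := pow_le_pow_right₀ hx (by norm_num)
  have p68 : x ^ 6 ≤ x ^ 8 := pow_le_pow_right₀ hx (by norm_num)
  have p58 : x ^ 5 ≤ x ^ 8 := pow_le_pow_right₀ hx (by norm_num)
  have hσ' : σ ≤ 10 * (x ^ 8 * b) := by
    have h1 : g * (b * x ^ 2) ≤ 2 * x ^ 6 * (b * x ^ 2) := by gcongr
    have h2 : x ^ 8 ≤ x ^ 8 * b := le_mul_of_one_le_right (by positivity) hb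
    have h3 : 2 * x ^ 6 * (b * x ^ 2) = 2 * (x ^ 8 * b) := by ring
    linarith
  have hW : 4 * x ^ 3 + 2 + b * x ^ 2 ≤ 7 * (x ^ 3 * b) := by
    have h1 : b * x ^ 2 ≤ b * x ^ 3 := by gcongr
    have h2 : x ^ 3 ≤ x ^ 3 * b := le_mul_of_one_le_right (by positivity) hb
    linarith
  have t1 : l * (H * x ^ 4) ≤ H * x ^ 4 * b ^ 2 := by
    calc l * (H * x ^ 4) ≤ b ^ 2 * (H * x ^ 4) := by gcongr; linarith
      _ = _ := by ring
  have t2 : 2 * H * n ≤ 2 * (H * x ^ 4 * b ^ 2) := by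
    have h1 : n ≤ x ^ 4 * b ^ 2 :=
      (hn.trans p34).trans (le_mul_of_one_le_right (by positivity) (by nlinarith))
    calc 2 * H * n ≤ 2 * H * (x ^ 4 * b ^ 2) := by gcongr
      _ = _ := by ring
  have t3 : b * (H * x ^ 2) ≤ H * x ^ 4 * b ^ 2 := by
    calc b * (H * x ^ 2) ≤ b ^ 2 * (H * x ^ 4) := by gcongr
      _ = _ := by ring
  -- The dominant part of σ is g·b/γ with g ≤ 2x⁶ and 1/γ = x², of order x⁸; the learning rate
  -- brings it down to the order x⁴ of log A/η.
  have t4 : H⁻¹ * (x ^ 4)⁻¹ * (H * (2 * H * σ +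
        b * ((4 * x ^ 3 + 2 + b * x ^ 2) * (H * x ^ 2)))) ≤ 27 * (H * x ^ 4 * b ^ 2) := by
    calc _ ≤ H⁻¹ * (x ^ 4)⁻¹ * (H * (2 * H * (10 * (x ^ 8 * b)) +
          b * (7 * (x ^ 3 * b) * (H * x ^ 2)))) := by gcongr
      _ = (x ^ 4)⁻¹ * H * (20 * (x ^ 8 * b) + 7 * (x ^ 5 * b ^ 2)) := by field_simp; ring
      _ ≤ (x ^ 4)⁻¹ * H * (20 * (x ^ 8 * b ^ 2) + 7 * (x ^ 8 * b ^ 2)) := by gcongr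
      _ = _ := by field_simp; ring
  linarith

/-- The factor 2 joins the bias of the estimates and the second-order term of the lower deviation.
In 36, exponential weights give 31, the two fluctuations of the estimates give 1 each, and the
episodes that are not good give 3. -/
lemma phase_regret_le (hc : ∀ i < K, ∀ h s a, c (i + 1) h s a ∈ Set.Icc (0 : ℝ) 1) (hH : 0 < H)
    {b : ℝ} (hb : 1 ≤ b) (hlog : Real.log (Fintype.card A) ≤ b)
    (hE : PhaseEvent p s₀ c d ω K e b) (π' : Policy S A H) {m : ℕ}
    (hm : m ∈ phaseSet (fun i => d (i + 1)) K e)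
    (hmax : ∀ i ∈ phaseSet (fun i => d (i + 1)) K e, i ≤ m)
    (hseen : seenDelay (fun i => d (i + 1)) m ≤ 2 ^ e) :
    ∑ k ∈ phaseSet (fun i => d (i + 1)) K e,
      (value p (runPolicy p s₀ c d ω k) (c (k + 1)) s₀ - value p π' (c (k + 1)) s₀) ≤
    2 * (H * Fintype.card S * Fintype.card A) *
        ((phaseSet (fun i => d (i + 1)) K e).card / phaseScale e ^ 2) +
      36 * (H ^ 2 * phaseScale e ^ 4 * b ^ 2) := by
  set D : ℕ → ℕ := fun i => d (i + 1) with hD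
  set x := phaseScale e with hxdef
  have hx : 1 ≤ x := one_le_phaseScale e
  have hx0 : 0 < x := by linarith
  have hH1 : (1 : ℝ) ≤ H := by exact_mod_cast hH
  have hγ : explorationParam e = (x ^ 2)⁻¹ := explorationParam_eq e
  have hx6 : x ^ 6 = 2 ^ e := phaseScale_pow_six e
  have hβ : skipThreshold e = x ^ 3 := skipThreshold_eq e
  have hg : ((goodSet D K e).card : ℝ) ≤ (phaseSet D K e).card := by
    exact_mod_cast Finset.card_le_card goodSet_subset_phaseSet
  have hn : ((phaseSet D K e).card : ℝ) ≤ 2 * x ^ 6 := by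
    have h1 : ((phaseSet D K e).card : ℝ) ≤ 2 ^ e + 1 := by
      exact_mod_cast card_phaseSet_le hmax hseen
    have h2 : (1 : ℝ) ≤ 2 ^ e := one_le_pow₀ one_le_two
    rw [hx6]; linarith
  have hdiv : ∀ y : ℝ, y / (x ^ 2)⁻¹ = y * x ^ 2 := fun y => by rw [div_inv_eq_mul]
  -- the comparison with the estimated costs
  have hB₁ : ∀ h s, ∑ j ∈ goodSet D K e,
      (expect (runPolicy p s₀ c d ω j h s) (fun a => estimatedQ p s₀ c d ω e j h s a) -
        expect (π' h s) (fun a => estimatedQ p s₀ c d ω e j h s a)) ≤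
      31 * (H * x ^ 4 * b ^ 2) := by
    intro h s
    refine (hedge_phase_le p s₀ c d ω hc hH hb hE π' h s).trans ?_
    have hst : ((staleSet D K e).card : ℝ) ≤ x ^ 3 := by
      rw [← hβ]
      refine le_trans (Nat.cast_le.2 card_staleSet_le) (Nat.floor_le ?_)
      rw [hβ]; positivity
    have hN : ((∑ j ∈ goodSet D K e, (overlapSet D K e j).card : ℕ) : ℝ) ≤
        (goodSet D K e).card + 2 * x ^ 6 := by
      rw [hx6]
      have h1 := (sum_card_overlapSet_le (D := D) (K := K) (e := e)).trans
        (Nat.add_le_add_left (Nat.mul_le_mul_left 2 (sum_delay_usedSet_le hmax hseen)) _)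
      exact_mod_cast h1
    have hσ : ∑ j ∈ goodSet D K e, (2 * ((overlapSet D K e j).card : ℝ) + b * x ^ 2) =
        2 * ((∑ j ∈ goodSet D K e, (overlapSet D K e j).card : ℕ) : ℝ) +
          (goodSet D K e).card * (b * x ^ 2) := by
      rw [Finset.sum_add_distrib, Finset.sum_const, nsmul_eq_mul, ← Finset.mul_sum]
      push_cast
      rfl
    have key := hedge_bound_le hH1 hx hb hlog hst (hg.trans hn) hN hσ
    rw [hγ, hβ, learningRate_eq, hdiv, hdiv]
    refine le_trans (le_of_eq ?_) key
    congr 2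
    rw [div_eq_mul_inv, mul_inv, inv_inv, inv_inv]
  have hB₂ : ∀ h s a, ∑ j ∈ goodSet D K e,
      (runEstimate p s₀ c d ω e j h s a - c (j + 1) h s a) ≤ b * x ^ 2 := by
    intro h s a
    have h1 := hE.cost h s a
    rw [← Finset.mul_sum, hγ, inv_mul_le_iff₀ (by positivity)] at h1
    linarith
  have hhedge := sum_evalV_sub_evalV_le (goodSet D K e) p (fun j => runPolicy p s₀ c d ω j) π'
    (fun j => runEstimate p s₀ c d ω e j) (fun j => c (j + 1)) hB₁ hB₂ s₀
  -- the estimation error of the played policies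
  have hval : ∑ j ∈ goodSet D K e, (value p (runPolicy p s₀ c d ω j) (c (j + 1)) s₀ -
      value p (runPolicy p s₀ c d ω j) (runEstimate p s₀ c d ω e j) s₀) ≤
      2 * (H * Fintype.card S * Fintype.card A) * ((phaseSet D K e).card / x ^ 2) +
        H * (b * x ^ 2) := by
    have h1 := hE.value
    rw [hγ, div_mul_cancel₀ _ (by linarith : (H : ℝ) ≠ 0), Finset.sum_sub_distrib, ← Finset.mul_sum,
      Finset.sum_const, nsmul_eq_mul] at h1
    simp only [sub_right_comm _ ((x ^ 2)⁻¹ * _)] at h1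
    rw [Finset.sum_sub_distrib, Finset.sum_const, nsmul_eq_mul] at h1
    set X := ∑ j ∈ goodSet D K e, (value p (runPolicy p s₀ c d ω j) (c (j + 1)) s₀ -
      value p (runPolicy p s₀ c d ω j) (runEstimate p s₀ c d ω e j) s₀)
    set Y : ℝ := H * Fintype.card S * Fintype.card A with hY
    set g : ℝ := ((goodSet D K e).card : ℝ)
    have h2 : (x ^ 2)⁻¹ / H * (X - g * ((x ^ 2)⁻¹ * Y)) ≤ b + g * ((x ^ 2)⁻¹) ^ 2 := by linarith
    have h3 : X - g * ((x ^ 2)⁻¹ * Y) ≤ (b + g * ((x ^ 2)⁻¹) ^ 2) * (H * x ^ 2) := by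
      have h4 : (x ^ 2)⁻¹ / H * (X - g * ((x ^ 2)⁻¹ * Y)) =
          (X - g * ((x ^ 2)⁻¹ * Y)) / (H * x ^ 2) := by field_simp
      rwa [h4, div_le_iff₀ (by positivity)] at h2
    have h5 : (b + g * ((x ^ 2)⁻¹) ^ 2) * (H * x ^ 2) = H * (b * x ^ 2) + H * (g / x ^ 2) := by
      field_simp
    have h6 : g * ((x ^ 2)⁻¹ * Y) = Y * (g / x ^ 2) := by field_simp
    have hHY : (H : ℝ) ≤ Y := by
      have hS : (1 : ℝ) ≤ Fintype.card S := by exact_mod_cast Fintype.card_pos_iff.2 ⟨s₀⟩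
      have hA : (1 : ℝ) ≤ Fintype.card A := by exact_mod_cast Fintype.card_pos
      rw [hY, mul_assoc]
      exact le_mul_of_one_le_right (by linarith) (one_le_mul_of_one_le_of_one_le hS hA)
    have h7 : g / x ^ 2 ≤ (phaseSet D K e).card / x ^ 2 := by gcongr
    have h8 : 0 ≤ g / x ^ 2 := by positivity
    have hY0 : 0 ≤ Y := by linarith
    have h9 : H * (g / x ^ 2) ≤ Y * (g / x ^ 2) := by gcongr
    have h10 : Y * (g / x ^ 2) ≤ Y * ((phaseSet D K e).card / x ^ 2) := by gcongr
    linarith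
  -- the other episodes
  have hbad : ∑ k ∈ phaseSet D K e \ goodSet D K e,
      (value p (runPolicy p s₀ c d ω k) (c (k + 1)) s₀ - value p π' (c (k + 1)) s₀) ≤
      H * (3 * x ^ 3) := by
    have h1 := card_phaseSet_sdiff_goodSet_le hm hmax hseen
    have x3 : (1 : ℝ) ≤ x ^ 3 := one_le_pow₀ hx
    have h2 : (2 : ℝ) ^ e / x ^ 3 = x ^ 3 := by rw [← hx6]; field_simp
    rw [hβ, h2] at h1
    calc _ ≤ ∑ _k ∈ phaseSet D K e \ goodSet D K e, (H : ℝ) := Finset.sum_le_sum fun k hk =>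
          value_sub_value_le p s₀ _ _
            (hc k (mem_phaseSet.1 (Finset.mem_sdiff.1 hk).1).1)
      _ = H * (phaseSet D K e \ goodSet D K e).card := by
          rw [Finset.sum_const, nsmul_eq_mul, mul_comm]
      _ ≤ _ := by gcongr; linarith
  rw [← Finset.sum_sdiff goodSet_subset_phaseSet]
  have hgood : ∑ k ∈ goodSet D K e,
      (value p (runPolicy p s₀ c d ω k) (c (k + 1)) s₀ - value p π' (c (k + 1)) s₀) =
      ∑ j ∈ goodSet D K e, (value p (runPolicy p s₀ c d ω j) (c (j + 1)) s₀ -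
        value p (runPolicy p s₀ c d ω j) (runEstimate p s₀ c d ω e j) s₀) +
      ∑ j ∈ goodSet D K e, (evalV p (runPolicy p s₀ c d ω j) (runEstimate p s₀ c d ω e j) s₀ -
        evalV p π' (c (j + 1)) s₀) := by
    rw [← Finset.sum_add_distrib]
    refine Finset.sum_congr rfl fun j _ => ?_
    simp only [value_eq_evalV]
    ring
  rw [hgood]
  have hbb : b ≤ b ^ 2 := by nlinarith
  have hHH : (H : ℝ) ≤ (H : ℝ) ^ 2 := by nlinarith
  have h1b : 1 ≤ b ^ 2 := by nlinarith
  have f1 : H * (3 * x ^ 3) ≤ 3 * (H ^ 2 * x ^ 4 * b ^ 2) := by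
    have p34 : x ^ 3 ≤ x ^ 4 := pow_le_pow_right₀ hx (by norm_num)
    calc H * (3 * x ^ 3) = 3 * (H * x ^ 3 * 1) := by ring
      _ ≤ _ := by gcongr
  have f2 : H * (b * x ^ 2) ≤ H ^ 2 * x ^ 4 * b ^ 2 := by
    have p24 : x ^ 2 ≤ x ^ 4 := pow_le_pow_right₀ hx (by norm_num)
    calc H * (b * x ^ 2) = H * x ^ 2 * b := by ring
      _ ≤ _ := by gcongr
  have f3 : (H : ℝ) * (31 * (H * x ^ 4 * b ^ 2) + b * x ^ 2) =
      31 * (H ^ 2 * x ^ 4 * b ^ 2) + H * (b * x ^ 2) := by ring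
  linarith

end PhaseRegret

/-! ### The family of deviations and its exponential moments -/

section Concentration

variable {S : Type u} {A : Type v} [Fintype S] [Fintype A] {H : ℕ}
  (p : Transition S A H) (s₀ : S) (c : ℕ → CostFn S A H) (d : ℕ → ℕ) (K : ℕ) (b : ℝ)

/-- The deviations bounded in `PhaseEvent` for the phase of episode `j`, as functions of the
policy `π` and the trajectory `x` of episode `k`. -/
noncomputable def deviation (j : ℕ) (h : Fin H) (s : S) (a : A) (n : Fin 5) (k : ℕ)
    (π : Policy S A H) (x : Trajectory S A H) : ℝ :=
  let D : ℕ → ℕ := fun i => d (i + 1)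
  let e := phaseAt D j
  let γ := explorationParam e
  let est := estimatedCost p s₀ γ (c (k + 1)) π x
  match n with
  | 0 => if k ∈ goodSet D K e then
      γ / H * ((value p π (c (k + 1)) s₀ - γ * (H * Fintype.card S * Fintype.card A)) -
        value p π est s₀) - (γ / H * H) ^ 2 else 0
  | 1 => if k ∈ goodSet D K e then γ * (est h s a - c (k + 1) h s a) else 0
  | 2 => if k ∈ staleSet D K e then (evalQ p π est h s a - 2 * H) / (H / γ) else 0
  | 3 => if k ∈ overlapSet D K e j then (evalQ p π est h s a - 2 * H) / (H / γ) else 0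
  | 4 => if k ∈ goodSet D K e then
      ((2 * (overlapSet D K e k).card + b / γ) * expect (π h s) (fun a => evalQ p π est h s a) -
        2 * ((2 * (overlapSet D K e k).card + b / γ) * H)) /
        ((4 * skipThreshold e + 2 + b / γ) * (H / γ)) else 0

lemma expect_exp_ite_le_one {X : Type*} [Fintype X] (P : PMF X) (q : Prop) [Decidable q]
    (f : X → ℝ) (h : q → expect P (fun x => Real.exp (f x)) ≤ 1) :
    expect P (fun x => Real.exp (if q then f x else 0)) ≤ 1 := by
  by_cases hq : q
  · simpa [hq] using h hq
  · simp [hq, expect_const]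

/-- The membership tests are deterministic, so an episode outside the set contributes exp 0 = 1, and
an episode inside falls under one of the moment bounds for nonnegative bounded variables or for
implicit exploration. -/
lemma expect_exp_deviation_le_one (hc : ∀ i < K, ∀ h s a, c (i + 1) h s a ∈ Set.Icc (0 : ℝ) 1)
    (hH : 0 < H) (hb : 0 ≤ b) (j : ℕ) (h : Fin H) (s : S) (a : A) (n : Fin 5) {k : ℕ} (hk : k < K)
    (π : Policy S A H) :
    expect (trajectoryLaw p π s₀)
      (fun x => Real.exp (deviation p s₀ c d K b j h s a n k π x)) ≤ 1 := by
  have hck := hc k hk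
  set D : ℕ → ℕ := fun i => d (i + 1) with hD
  set e := phaseAt D j with he
  have hγ := explorationParam_pos e
  have hH' : (0 : ℝ) < H := by exact_mod_cast hH
  have hQ : expect (trajectoryLaw p π s₀) (fun x => Real.exp ((evalQ p π
      (estimatedCost p s₀ (explorationParam e) (c (k + 1)) π x) h s a - 2 * H) /
        (H / explorationParam e))) ≤ 1 :=
    expect_exp_le_one_of_mean_le _ (by positivity)
      (fun x => evalQ_estimatedCost_nonneg p s₀ hγ hck π x h s a)
      (fun x => evalQ_estimatedCost_le p s₀ hγ hck π x h s a)
      (expect_evalQ_estimatedCost_le p s₀ hγ hck π h s a)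
  match n with
  | 0 =>
    refine expect_exp_ite_le_one _ _ _ fun _ => ?_
    refine expect_exp_neg_le_one _ (by positivity) ?_
      (value_estimatedCost_nonneg p s₀ hγ hck π) (value_estimatedCost_le p s₀ hγ hck π)
      (value_sub_le_expect_value_estimatedCost p s₀ hγ hck π)
    rw [div_mul_cancel₀ _ hH'.ne', explorationParam_eq]
    exact inv_le_one_of_one_le₀ (one_le_pow₀ (one_le_phaseScale e))
  | 1 =>
    exact expect_exp_ite_le_one _ _ _ fun _ =>
      expect_exp_estimatedCost_sub_le_one p s₀ hγ hck π h s a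
  | 2 => exact expect_exp_ite_le_one _ _ _ fun _ => hQ
  | 3 => exact expect_exp_ite_le_one _ _ _ fun _ => hQ
  | 4 =>
    refine expect_exp_ite_le_one _ _ _ fun hkg => ?_
    have hβ : 0 < skipThreshold e := Real.rpow_pos_of_pos two_pos _
    have hw0 : 0 ≤ 2 * ((overlapSet D K e k).card : ℝ) + b / explorationParam e := by positivity
    have hw : 2 * ((overlapSet D K e k).card : ℝ) + b / explorationParam e ≤
        4 * skipThreshold e + 2 + b / explorationParam e := by
      have h1 : ((overlapSet D K e k).card : ℝ) ≤ 2 * ⌊skipThreshold e⌋₊ + 1 := by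
        exact_mod_cast card_overlapSet_le (goodSet_subset_usedSet hkg)
      have h2 := Nat.floor_le hβ.le
      linarith
    have hV0 : ∀ x, 0 ≤ expect (π h s) fun a => evalQ p π
        (estimatedCost p s₀ (explorationParam e) (c (k + 1)) π x) h s a := fun x =>
      expect_nonneg _ fun a => evalQ_estimatedCost_nonneg p s₀ hγ hck π x h s a
    refine expect_exp_le_one_of_mean_le _ (by positivity) (fun x => mul_nonneg hw0 (hV0 x))
      (fun x => mul_le_mul hw (expect_le_of_le _ fun a =>
        evalQ_estimatedCost_le p s₀ hγ hck π x h s a) (hV0 x) (by positivity)) ?_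
    rw [expect_const_mul, expect_comm]
    exact mul_le_mul_of_nonneg_left (expect_le_of_le _ fun a =>
      expect_evalQ_estimatedCost_le p s₀ hγ hck π h s a) hw0

lemma sum_fin_ite_mem {I : Finset ℕ} (hI : I ⊆ Finset.range K) (g : ℕ → ℝ) :
    ∑ k : Fin K, (if (k : ℕ) ∈ I then g k else 0) = ∑ k ∈ I, g k := by
  rw [Fin.sum_univ_eq_sum_range (fun k => if k ∈ I then g k else 0), Finset.sum_ite_mem,
    Finset.inter_eq_right.2 hI]

lemma usedSet_subset_range {D : ℕ → ℕ} {K e : ℕ} : usedSet D K e ⊆ Finset.range K := by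
  intro i hi
  have := (mem_usedSet.1 hi).1
  exact Finset.mem_range.2 (by omega)

/-- Indexing by episodes instead of phases keeps the union bound at K: any episode represents its
phase, and overlaps need their own episode as index anyway. -/
lemma phaseEvent_of_deviation_le [Nonempty A] (hH : 0 < H) (ω : ℕ → Trajectory S A H)
    (hdev : ∀ (j : Fin K) (h : Fin H) (s : S) (a : A) (n : Fin 5),
      ∑ k : Fin K, deviation p s₀ c d K b j h s a n k (runPolicy p s₀ c d ω k) (ω k) ≤ b)
    {e : ℕ} {j : ℕ} (hj : j ∈ phaseSet (fun i => d (i + 1)) K e) :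
    PhaseEvent p s₀ c d ω K e b := by
  obtain ⟨hjK, rfl⟩ := mem_phaseSet.1 hj
  refine ⟨?_, fun h s a => ?_, fun h s a => ?_, fun i hi h s a => ?_, fun h s => ?_⟩
  · refine (sum_fin_ite_mem K (goodSet_subset_usedSet.trans usedSet_subset_range) _).symm.trans_le ?_
    exact hdev ⟨j, hjK⟩ ⟨0, hH⟩ s₀ (Classical.arbitrary A) 0
  · refine (sum_fin_ite_mem K (goodSet_subset_usedSet.trans usedSet_subset_range) _).symm.trans_le ?_
    exact hdev ⟨j, hjK⟩ h s a 1
  · refine (sum_fin_ite_mem K ((Finset.filter_subset _ _).trans usedSet_subset_range)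
      _).symm.trans_le ?_
    exact hdev ⟨j, hjK⟩ h s a 2
  · obtain ⟨hiK, hie⟩ := mem_phaseSet.1 (goodSet_subset_phaseSet hi)
    refine (sum_fin_ite_mem K ((Finset.filter_subset _ _).trans usedSet_subset_range)
      _).symm.trans_le ?_
    have := hdev ⟨i, hiK⟩ h s a 3
    simp only [deviation, hie] at this
    exact this
  · refine (sum_fin_ite_mem K (goodSet_subset_usedSet.trans usedSet_subset_range) _).symm.trans_le ?_
    exact hdev ⟨j, hjK⟩ h s (Classical.arbitrary A) 4

end Concentration

/-! ### Summation over phases and the final bound -/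

section Regret

variable {S : Type u} {A : Type v} [Fintype S] [Fintype A] [Nonempty A] {H : ℕ}

lemma regret_le (p : Transition S A H) (s₀ : S) (c : ℕ → CostFn S A H) (d : ℕ → ℕ) {K : ℕ}
    (u : Fin K → Trajectory S A H) {B : ℝ}
    (hB : ∀ π' : Policy S A H, ∑ k ∈ Finset.range K,
      (value p (runPolicy p s₀ c d (extendHistory s₀ u) k) (c (k + 1)) s₀ -
        value p π' (c (k + 1)) s₀) ≤ B) :
    regret (doublingOPPO p s₀) p s₀ c d u ≤ B := by
  rw [regret, sub_le_iff_le_add, ← sub_le_iff_le_add']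
  have : Nonempty (Policy S A H) := ⟨uniformPolicy⟩
  refine le_ciInf fun π' => ?_
  have := hB π'
  rw [Finset.sum_range, Finset.sum_sub_distrib] at this
  simp only [playedPolicy_eq_runPolicy]
  linarith

lemma sum_range_delay (d : ℕ → ℕ) (K : ℕ) :
    ∑ k ∈ Finset.Icc 1 K, d k = ∑ i ∈ Finset.range K, d (i + 1) := by
  induction K with
  | zero => simp
  | succ K ih => rw [Finset.sum_Icc_succ_top (by omega), ih, Finset.sum_range_succ]

lemma phaseScale_pow_four_le {D : ℕ → ℕ} {K e m : ℕ} (hm : m ∈ phaseSet D K e) :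
    phaseScale e ^ 4 ≤ 2 * ((K : ℝ) ^ (2 / 3 : ℝ) +
      ((∑ i ∈ Finset.range K, D i : ℕ) : ℝ) ^ (2 / 3 : ℝ)) := by
  obtain ⟨hmK, rfl⟩ := mem_phaseSet.1 hm
  set T := ∑ i ∈ Finset.range K, D i with hT
  have h1 : 2 ^ phaseAt D m ≤ 2 * (K + T) := by
    have h2 := two_pow_phaseAt_le (D := D) m
    have h3 := seenDelay_le (D := D) m
    have h4 : ∑ i ∈ Finset.range m, D i ≤ T :=
      Finset.sum_le_sum_of_subset (Finset.range_mono hmK.le)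
    omega
  have h2 : phaseScale (phaseAt D m) ^ 4 = ((2 : ℝ) ^ phaseAt D m) ^ (2 / 3 : ℝ) := by
    rw [phaseScale_pow, ← Real.rpow_natCast, ← Real.rpow_mul two_pos.le]
    congr 1; push_cast; ring
  have h3 : (2 : ℝ) ^ phaseAt D m ≤ 2 * (K + T) := by exact_mod_cast h1
  have h4 : (2 : ℝ) ^ (2 / 3 : ℝ) ≤ 2 := by
    conv_rhs => rw [← Real.rpow_one 2]
    exact Real.rpow_le_rpow_of_exponent_le one_le_two (by norm_num)
  calc phaseScale (phaseAt D m) ^ 4 ≤ (2 * ((K : ℝ) + T)) ^ (2 / 3 : ℝ) := by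
        rw [h2]; gcongr
    _ = 2 ^ (2 / 3 : ℝ) * ((K : ℝ) + T) ^ (2 / 3 : ℝ) :=
        Real.mul_rpow two_pos.le (by positivity)
    _ ≤ 2 * ((K : ℝ) ^ (2 / 3 : ℝ) + (T : ℝ) ^ (2 / 3 : ℝ)) := by
        gcongr
        exact Real.rpow_add_le_add_rpow (Nat.cast_nonneg _) (Nat.cast_nonneg _) (by norm_num)
          (by norm_num)

/-- Write n as n^(1/3)·n^(2/3) and use one bound on each factor. Combining both bounds on the length
of a phase keeps the delays out of the term with HSA. -/
lemma div_sq_le_rpow {n x K : ℝ} (hn0 : 0 < n) (hx : 0 < x) (hn : n ≤ 2 * x ^ 6) (hK : n ≤ K) :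
    n / x ^ 2 ≤ 2 * K ^ (2 / 3 : ℝ) := by
  have h1 : n ^ (1 / 3 : ℝ) ≤ 2 * x ^ 2 := by
    have h2 : n ≤ (2 * x ^ 2) ^ 3 := by
      have : 0 < x ^ 6 := by positivity
      have h3 : (2 * x ^ 2) ^ 3 = 8 * x ^ 6 := by ring
      linarith
    calc n ^ (1 / 3 : ℝ) ≤ ((2 * x ^ 2) ^ 3) ^ (1 / 3 : ℝ) := by gcongr
      _ = 2 * x ^ 2 := by
        rw [← Real.rpow_natCast, ← Real.rpow_mul (by positivity)]
        norm_num
  have h2 : n = n ^ (1 / 3 : ℝ) * n ^ (2 / 3 : ℝ) := by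
    rw [← Real.rpow_add hn0]; norm_num
  rw [div_le_iff₀ (by positivity)]
  calc n = n ^ (1 / 3 : ℝ) * n ^ (2 / 3 : ℝ) := h2
    _ ≤ 2 * x ^ 2 * K ^ (2 / 3 : ℝ) := by gcongr
    _ = _ := by ring

lemma phase_regret_le_uniform (p : Transition S A H) (s₀ : S) (c : ℕ → CostFn S A H) (d : ℕ → ℕ)
    (ω : ℕ → Trajectory S A H) {K e : ℕ}
    (hc : ∀ i < K, ∀ h s a, c (i + 1) h s a ∈ Set.Icc (0 : ℝ) 1) (hH : 0 < H) (hK : 0 < K)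
    {b : ℝ} (hb : 1 ≤ b) (hlog : Real.log (Fintype.card A) ≤ b)
    (hE : (phaseSet (fun i => d (i + 1)) K e).Nonempty → PhaseEvent p s₀ c d ω K e b)
    (π' : Policy S A H) :
    ∑ k ∈ phaseSet (fun i => d (i + 1)) K e,
      (value p (runPolicy p s₀ c d ω k) (c (k + 1)) s₀ - value p π' (c (k + 1)) s₀) ≤
    4 * (H * Fintype.card S * Fintype.card A) * (K : ℝ) ^ (2 / 3 : ℝ) +
      72 * (H ^ 2 * b ^ 2 * ((K : ℝ) ^ (2 / 3 : ℝ) +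
        ((∑ i ∈ Finset.range K, d (i + 1) : ℕ) : ℝ) ^ (2 / 3 : ℝ))) := by
  set D : ℕ → ℕ := fun i => d (i + 1) with hD
  rcases (phaseSet D K e).eq_empty_or_nonempty with h0 | hne
  · rw [h0, Finset.sum_empty]
    positivity
  set m := (phaseSet D K e).max' hne with hmdef
  have hm : m ∈ phaseSet D K e := Finset.max'_mem _ _
  have hmax : ∀ i ∈ phaseSet D K e, i ≤ m := fun i hi => Finset.le_max' _ _ hi
  have hx4 := phaseScale_pow_four_le hm
  -- A phase of a single episode may have an estimate far above 2^e, but it costs at most H.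
  by_cases hlong : ∃ a ∈ phaseSet D K e, a < m
  · obtain ⟨a, ha, ham⟩ := hlong
    have hseen := seenDelay_le_two_pow ham (mem_phaseSet.1 ha).2 (mem_phaseSet.1 hm).2
    refine (phase_regret_le p s₀ c d ω hc hH hb hlog (hE hne) π' hm hmax hseen).trans ?_
    have hn : ((phaseSet D K e).card : ℝ) ≤ 2 * phaseScale e ^ 6 := by
      have h1 : ((phaseSet D K e).card : ℝ) ≤ 2 ^ e + 1 := by
        exact_mod_cast card_phaseSet_le hmax hseen
      have h2 : (1 : ℝ) ≤ 2 ^ e := one_le_pow₀ one_le_two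
      rw [phaseScale_pow_six]; linarith
    have hnK : ((phaseSet D K e).card : ℝ) ≤ K := by
      have h1 := Finset.card_le_card (Finset.filter_subset (fun i => phaseAt D i = e)
        (Finset.range K))
      rw [Finset.card_range] at h1
      exact_mod_cast h1
    have hn0 : (0 : ℝ) < (phaseSet D K e).card := by exact_mod_cast hne.card_pos
    have h3 := div_sq_le_rpow hn0 (phaseScale_pos e) hn hnK
    have h4 : 2 * (H * Fintype.card S * Fintype.card A : ℝ) *
        ((phaseSet D K e).card / phaseScale e ^ 2) ≤
        2 * (H * Fintype.card S * Fintype.card A) * (2 * (K : ℝ) ^ (2 / 3 : ℝ)) := by gcongr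
    have h5 : 36 * ((H : ℝ) ^ 2 * phaseScale e ^ 4 * b ^ 2) ≤ 36 * ((H : ℝ) ^ 2 *
        (2 * ((K : ℝ) ^ (2 / 3 : ℝ) +
        ((∑ i ∈ Finset.range K, D i : ℕ) : ℝ) ^ (2 / 3 : ℝ))) * b ^ 2) := by gcongr
    linarith
  · push Not at hlong
    have hsing : phaseSet D K e = {m} := Finset.eq_singleton_iff_unique_mem.2
      ⟨hm, fun i hi => le_antisymm (hmax i hi) (hlong i hi)⟩
    rw [hsing, Finset.sum_singleton]
    refine (value_sub_value_le p s₀ _ _ (hc m (mem_phaseSet.1 hm).1)).trans ?_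
    have hS : (1 : ℝ) ≤ Fintype.card S := by exact_mod_cast Fintype.card_pos_iff.2 ⟨s₀⟩
    have hA : (1 : ℝ) ≤ Fintype.card A := by exact_mod_cast Fintype.card_pos
    have hK1 : (1 : ℝ) ≤ (K : ℝ) ^ (2 / 3 : ℝ) :=
      Real.one_le_rpow (by exact_mod_cast hK) (by norm_num)
    have h1 : (H : ℝ) * 1 * 1 * 1 ≤
        H * Fintype.card S * Fintype.card A * (K : ℝ) ^ (2 / 3 : ℝ) := by gcongr
    have h2 : 0 ≤ 72 * ((H : ℝ) ^ 2 * b ^ 2 * ((K : ℝ) ^ (2 / 3 : ℝ) +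
        ((∑ i ∈ Finset.range K, d (i + 1) : ℕ) : ℝ) ^ (2 / 3 : ℝ))) := by positivity
    linarith

/-- The regret bound on the event that all deviations are small. -/
lemma sum_value_sub_value_le (p : Transition S A H) (s₀ : S) (c : ℕ → CostFn S A H) (d : ℕ → ℕ)
    (ω : ℕ → Trajectory S A H) {K : ℕ}
    (hc : ∀ i < K, ∀ h s a, c (i + 1) h s a ∈ Set.Icc (0 : ℝ) 1) (hH : 0 < H) (hK : 0 < K)
    (hHS : H ^ 2 ≤ Fintype.card S) {b : ℝ} (hb : 1 ≤ b)
    (hlogA : Real.log (Fintype.card A) ≤ b) (hlogK : Real.log (2 * K) ≤ b)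
    (hE : ∀ e, (phaseSet (fun i => d (i + 1)) K e).Nonempty → PhaseEvent p s₀ c d ω K e b)
    (π' : Policy S A H) :
    ∑ k ∈ Finset.range K,
      (value p (runPolicy p s₀ c d ω k) (c (k + 1)) s₀ - value p π' (c (k + 1)) s₀) ≤
    304 * b ^ 3 * (H * Fintype.card S * Fintype.card A * (K : ℝ) ^ (2 / 3 : ℝ) +
      (H : ℝ) ^ 2 * ((∑ i ∈ Finset.range K, d (i + 1) : ℕ) : ℝ) ^ (2 / 3 : ℝ)) := by
  set D : ℕ → ℕ := fun i => d (i + 1) with hD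
  set Y : ℝ := (H * Fintype.card S * Fintype.card A : ℝ) with hY
  set K' : ℝ := (K : ℝ) ^ (2 / 3 : ℝ)
  set T' : ℝ := ((∑ i ∈ Finset.range K, d (i + 1) : ℕ) : ℝ) ^ (2 / 3 : ℝ)
  have hK'0 : 0 ≤ K' := by positivity
  have hT'0 : 0 ≤ T' := by positivity
  set E := phaseAt D (K - 1) with hEdef
  -- Truncated delays sum to at most K², so the number of phases is logarithmic in K whatever the
  -- total delay is.
  have hEb : (E : ℝ) ≤ 3 * b := by
    have h1 : 2 ^ E ≤ (2 * K) ^ 2 := by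
      have h2 := two_pow_phaseAt_le (D := D) (K - 1)
      have h3 := seenDelay_le_sq (D := D) (K - 1)
      obtain ⟨m, rfl⟩ : ∃ m, K = m + 1 := ⟨K - 1, by omega⟩
      simp only [Nat.add_sub_cancel] at h2 h3 hEdef
      rw [hEdef]
      nlinarith
    have h2 : (E : ℝ) * Real.log 2 ≤ 2 * Real.log (2 * K) := by
      have h3 : ((2 : ℝ) ^ E) ≤ (2 * K) ^ 2 := by exact_mod_cast h1
      have h4 := Real.log_le_log (by positivity) h3
      rw [Real.log_pow, Real.log_pow] at h4
      exact_mod_cast h4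
    have h3 := Real.log_two_gt_d9
    have h4 : (E : ℝ) * 0.6931471803 ≤ E * Real.log 2 := by gcongr
    nlinarith
  have hsum : ∑ k ∈ Finset.range K,
      (value p (runPolicy p s₀ c d ω k) (c (k + 1)) s₀ - value p π' (c (k + 1)) s₀) =
      ∑ e ∈ Finset.range (E + 1), ∑ k ∈ phaseSet D K e,
      (value p (runPolicy p s₀ c d ω k) (c (k + 1)) s₀ - value p π' (c (k + 1)) s₀) := by
    refine (Finset.sum_fiberwise_of_maps_to (fun k hk => Finset.mem_range.2 ?_) _).symm
    have hkK := Finset.mem_range.1 hk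
    exact Nat.lt_succ_of_le (phaseAt_mono D (by omega))
  rw [hsum]
  refine (Finset.sum_le_sum fun e _ =>
    phase_regret_le_uniform p s₀ c d ω hc hH hK hb hlogA (hE e) π').trans ?_
  rw [Finset.sum_const, Finset.card_range, nsmul_eq_mul]
  -- Here S ≥ H² enters, to absorb H²K^(2/3) into HSA·K^(2/3).
  have hHY : (H : ℝ) ^ 2 ≤ Y := by
    have h1 : (H : ℝ) ^ 2 ≤ Fintype.card S := by exact_mod_cast hHS
    have hH1 : (1 : ℝ) ≤ H := by exact_mod_cast hH
    have hA : (1 : ℝ) ≤ Fintype.card A := by exact_mod_cast Fintype.card_pos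
    calc (H : ℝ) ^ 2 ≤ 1 * Fintype.card S * 1 := by linarith
      _ ≤ Y := by rw [hY]; gcongr
  have hY0 : 0 ≤ Y := by positivity
  have hbb : 1 ≤ b ^ 2 := one_le_pow₀ hb
  have hbound : 4 * Y * K' + 72 * ((H : ℝ) ^ 2 * b ^ 2 * (K' + T')) ≤
      76 * b ^ 2 * (Y * K' + (H : ℝ) ^ 2 * T') := by
    have h1 : (H : ℝ) ^ 2 * b ^ 2 * K' ≤ Y * b ^ 2 * K' := by gcongr
    have h2 : Y * K' * 1 ≤ Y * K' * b ^ 2 := by gcongr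
    have h3 : 0 ≤ (H : ℝ) ^ 2 * b ^ 2 * T' := by positivity
    linarith
  have hE1 : ((E + 1 : ℕ) : ℝ) ≤ 4 * b := by push_cast; linarith
  calc ((E + 1 : ℕ) : ℝ) * (4 * Y * K' + 72 * ((H : ℝ) ^ 2 * b ^ 2 * (K' + T')))
      ≤ 4 * b * (76 * b ^ 2 * (Y * K' + (H : ℝ) ^ 2 * T')) := by gcongr
    _ = _ := by ring

end Regret

end DelayedMDP

open DelayedMDP in
/-- Regret of Delayed OPPO with known transitions, bandit feedback, skipping and doubling. -/
theorem mainTheorem6 :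
    ∃ (C : ℝ) (n : ℕ), 0 < C ∧
      ∀ (S : Type*) (A : Type*) [Fintype S] [Fintype A] [Nonempty A] (H : ℕ),
        Fintype.card A < Fintype.card S → H ^ 2 < Fintype.card S →
      ∀ (p : DelayedMDP.Transition S A H) (s₀ : S) (K : ℕ)
        (c : ℕ → DelayedMDP.CostFn S A H) (d : ℕ → ℕ),
        (∀ k ∈ Finset.Icc 1 K, ∀ h s a, c k h s a ∈ Set.Icc (0 : ℝ) 1) →
      ∀ δ : ℝ, 0 < δ → δ < 1 →
        ENNReal.ofReal (1 - δ) ≤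
          (DelayedMDP.interactionLaw (DelayedMDP.doublingOPPO p s₀) p s₀ c d K).toOuterMeasure
            {u | DelayedMDP.regret (DelayedMDP.doublingOPPO p s₀) p s₀ c d u ≤
              C * (1 + Real.log (H * Fintype.card S * Fintype.card A * K / δ)) ^ n *
                (H * Fintype.card S * Fintype.card A * (K : ℝ) ^ (2 / 3 : ℝ)
                  + (H : ℝ) ^ 2 * ((∑ k ∈ Finset.Icc 1 K, d k : ℕ) : ℝ) ^ (2 / 3 : ℝ))} := by
  -- 2432 = 304·2³, from b ≤ 2(1 + log R); of the three logarithms two come from each phase and one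
  -- from the number of phases.
  refine ⟨2432, 3, by norm_num, ?_⟩
  intro S A _ _ _ H _ hHS p s₀ K c d hc δ hδ0 hδ1
  have hc' : ∀ i < K, ∀ h s a, c (i + 1) h s a ∈ Set.Icc (0 : ℝ) 1 := fun i hi =>
    hc (i + 1) (Finset.mem_Icc.2 ⟨by omega, by omega⟩)
  rcases Nat.eq_zero_or_pos H with rfl | hH
  -- The bound holds surely, so the union over no events suffices.
  · refine one_sub_le_toOuterMeasure (ι := Empty) _ (fun i => i.elim) 0 δ (fun i => i.elim)
      (by simpa using hδ0.le) _ fun u _ => regret_le p s₀ c d u fun π' => ?_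
    simp [value]
  rcases Nat.eq_zero_or_pos K with rfl | hK
  · refine one_sub_le_toOuterMeasure (ι := Empty) _ (fun i => i.elim) 0 δ (fun i => i.elim)
      (by simpa using hδ0.le) _ fun u _ => regret_le p s₀ c d u fun π' => ?_
    simp
  have hH1 : (1 : ℝ) ≤ H := by exact_mod_cast hH
  have hK1 : (1 : ℝ) ≤ K := by exact_mod_cast hK
  have hS1 : (1 : ℝ) ≤ Fintype.card S := by exact_mod_cast Fintype.card_pos_iff.2 ⟨s₀⟩
  have hA1 : (1 : ℝ) ≤ Fintype.card A := by exact_mod_cast Fintype.card_pos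
  set Y : ℝ := (H * Fintype.card S * Fintype.card A : ℝ) with hY
  have hAY : (Fintype.card A : ℝ) ≤ Y := by
    calc (Fintype.card A : ℝ) = 1 * 1 * Fintype.card A := by ring
      _ ≤ Y := by rw [hY]; gcongr
  have hY1 : 1 ≤ Y := hA1.trans hAY
  set R : ℝ := Y * K / δ with hR
  have hYK : Y * K ≤ R := by
    rw [hR, le_div_iff₀ hδ0]
    exact mul_le_of_le_one_right (by positivity) hδ1.le
  have hYR : Y ≤ R := (le_mul_of_one_le_right (by linarith) hK1).trans hYK
  have hKR : K ≤ R := (le_mul_of_one_le_left (by linarith) hY1).trans hYK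
  have hR1 : 1 ≤ R := hY1.trans hYR
  -- The union runs over 5·HSAK deviations, so exp(-b) times their number is exactly δ.
  set b : ℝ := Real.log (5 * R) with hbdef
  have hb1 : 1 ≤ b := by
    rw [hbdef, Real.le_log_iff_exp_le (by positivity)]
    linarith [Real.exp_one_lt_d9]
  have hbA : Real.log (Fintype.card A) ≤ b := Real.log_le_log (by linarith) (by linarith)
  have hbK : Real.log (2 * K) ≤ b := Real.log_le_log (by linarith) (by linarith)
  have hb2 : b ≤ 2 * (1 + Real.log R) := by
    have h5 : Real.log 5 ≤ 2 := by
      rw [Real.log_le_iff_le_exp (by norm_num)]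
      have h1 := Real.exp_one_gt_d9
      have h2 : Real.exp 2 = Real.exp 1 * Real.exp 1 := by rw [← Real.exp_add]; norm_num
      nlinarith
    rw [hbdef, Real.log_mul (by norm_num) (by linarith)]
    linarith [Real.log_nonneg hR1]
  refine one_sub_le_toOuterMeasure (ι := Fin K × Fin H × S × A × Fin 5) _
    (fun τ u => ∑ k : Fin K, deviation p s₀ c d K b τ.1 τ.2.1 τ.2.2.1 τ.2.2.2.1 τ.2.2.2.2 k
      (playedPolicy (doublingOPPO p s₀) c d u k) (u k)) b δ (fun τ => ?_) ?_ _ fun u hu => ?_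
  · exact expect_interactionLaw_exp_sum_le_one _ p s₀ c d K
      (deviation p s₀ c d K b τ.1 τ.2.1 τ.2.2.1 τ.2.2.2.1 τ.2.2.2.2) fun k hk π =>
      expect_exp_deviation_le_one p s₀ c d K b hc' hH (by linarith) _ _ _ _ _ hk π
  · rw [Real.exp_neg, hbdef, Real.exp_log (by positivity)]
    simp only [Fintype.card_prod, Fintype.card_fin]
    push_cast
    rw [hR, hY]
    refine le_of_eq ?_
    field_simp
  · refine regret_le p s₀ c d u fun π' => ?_
    have hE : ∀ e, (phaseSet (fun i => d (i + 1)) K e).Nonempty →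
        PhaseEvent p s₀ c d (extendHistory s₀ u) K e b := by
      rintro e ⟨j, hj⟩
      refine phaseEvent_of_deviation_le p s₀ c d K b hH _ (fun j h s a n => ?_) hj
      have := hu (j, h, s, a, n)
      simp only [playedPolicy_eq_runPolicy] at this
      simpa only [extendHistory_apply] using this
    refine (sum_value_sub_value_le p s₀ c d _ hc' hH hK hHS.le hb1 hbA hbK hE π').trans ?_
    rw [sum_range_delay]
    have h1 : 304 * b ^ 3 ≤ 2432 * (1 + Real.log R) ^ 3 := by
      have h2 : b ^ 3 ≤ (2 * (1 + Real.log R)) ^ 3 := by gcongr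
      rw [mul_pow] at h2
      linarith
    gcongr
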